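/- Let $q$ be a power of a prime $p$, $A=\mathbb{F}_q[\theta]$, $K_\infty=\mathbb{F}_q((1/\theta))$, and let $\mathbb{C}_\infty$ be the completion of an algebraic closure of $K_\infty$, with its absolute value $|\cdot|$. Let $\Sigma$ be a finite set of positive integers. Let $\mathbb{E}_\Sigma$ be the $\mathbb{C}_\infty$-algebra of entire functions $\mathbb{C}_\infty^\Sigma\to\mathbb{C}_\infty$ in the variables $t_j$, $j\in\Sigma$, that is, of the power series $\sum_k c_k t^k$ with $|c_k|R^{|k|}\to0$ for every $R>0$. Let $\mathbb{C}_\infty[[X_\Sigma]]^{\mathrm{lin}}$ be the space of formal series in the $X_j$, $j\in\Sigma$, in which only monomials $\prod_j X_j^{q^{d_j}}$ occur. For $i=(i_j)_j\in\mathbb{N}^\Sigma$ write $\theta^{q^i}=(\theta^{q^{i_j}})_j\in\mathbb{C}_\infty^\Sigma$, $D_n=\prod_{k<n}(\theta^{q^n}-\theta^{q^k})$, $D_i=\prod_{j\in\Sigma}D_{i_j}$, and $B_i=\prod_{j\in\Sigma}\prod_{k<i_j}(t_j-\theta^{q^k})$. For $f\in\mathbb{E}_\Sigma$ there is a unique family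 $(f_i)_{i\in\mathbb{N}^\Sigma}$ in $\mathbb{C}_\infty$ such that the formal combination $\sum_i f_iB_i$ takes the same value as $f$ at every point $\theta^{q^k}$, $k\in\mathbb{N}^\Sigma$ (the sum is finite at each of these points). Define $$\mathcal{F}_\Sigma(f)=\sum_{i\in\mathbb{N}^\Sigma}f_i\prod_{j\in\Sigma}X_j^{q^{i_j}},\qquad \mathcal{E}_\Sigma(f)=\sum_{i\in\mathbb{N}^\Sigma}\frac{f(\theta^{q^i})}{D_i}\prod_{j\in\Sigma}\lambda_A\binom{\{j\}}{1}^{q^{i_j}},$$ where $$\lambda_A\binom{\{j\}}{1}=\sum_{d\ge0}\Big(\sum_{a\in A\text{ monic},\ \deg a=d}\frac1a\Big)X_j^{q^d};$$ each monomial receives only finitely many contributions in these sums. Let $\mathcal{Z}_\Sigma$ be the $\mathbb{F}_p$-vector space generated by the multiple zeta values in Tate algebras $$\sum_{\substack{a_1,\dots,a_r\in A\text{ monic}\\ \deg a_1>\cdots>\deg a_r}}\ \prod_{l=1}^r\frac{\prod_{j\in\Sigma_l}a_l(t_j)}{a_l^{n_l}}$$ with $r\ge0$, integers $n_1,\dots,n_r\ge1$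 and (possibly empty) disjoint sets $\Sigma_1,\dots,\Sigma_r$ with union $\Sigma$; the sum is the limit for the Gauss norm, and for $r=0$ (which requires $\Sigma=\emptyset$) it is $1$. Then: 1. $\mathcal{E}_\Sigma=\mathcal{F}_\Sigma$ as $\mathbb{C}_\infty$-linear maps $\mathbb{E}_\Sigma\to\mathbb{C}_\infty[[X_\Sigma]]^{\mathrm{lin}}$. 2. If $|\Sigma|<q$, then $\mathcal{Z}_\Sigma\subset\mathbb{E}_\Sigma$, and $\mathcal{E}_\Sigma$ and $\mathcal{F}_\Sigma$ agree on $\mathcal{Z}_\Sigma$. 3. $\lambda_A\binom{\{j\}}{1}=\log_C(X_j)$ for every $j\in\Sigma$, where $\log_C$ is the Carlitz logarithm, that is, the compositional inverse of $\exp_C(X)=\sum_{n\ge0}D_n^{-1}X^{q^n}$. 4. For every $f\in\mathbb{E}_\Sigma$, put $\tau_\Sigma(f)=\prod_{j\in\Sigma}(t_j-\theta)\cdot\tau(f)$, where $\tau$ raises the coefficients in $\mathbb{C}_\infty$ of a power series to the power $q$ and fixes the $t_j$. Then $\tau_\Sigma(f)\in\mathbb{E}_\Sigma$ and $\mathcal{E}_\Sigma(\tau_\Sigma(f))=\mathcal{E}_\Sigma(f)^q$.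 -/

import Mathlib

noncomputable section
open scoped NNReal

namespace TateMZV

/-- `K_∞ = F_q((1/θ))`; the formal variable of the Laurent series is `1/θ`. -/
abbrev KInf (Fq : Type*) [Field Fq] := LaurentSeries Fq

section CInf
variable (Fq : Type*) [Field Fq] [Fintype Fq]

open MonoidWithZeroHom.ValueGroup₀ in
/-- The `1/θ`-adic valuation, normalised as a real absolute value with `|θ| = q`. -/
instance : Valuation.RankOne (Valued.v : Valuation (KInf Fq) (WithZero (Multiplicative ℤ))) where
  hom' := (WithZeroMulInt.toNNReal (e := (Fintype.card Fq : ℝ≥0)) (by simp)).comp embedding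
  strictMono' := (WithZeroMulInt.toNNReal_strictMono
    (by exact_mod_cast Fintype.one_lt_card)).comp embedding_strictMono
  exists_val_nontrivial := ⟨HahnSeries.single 1 1, by
    rw [LaurentSeries.valuation_single_zpow]; simp⟩

instance : NontriviallyNormedField (KInf Fq) :=
  Valued.toNontriviallyNormedField (KInf Fq) (WithZero (Multiplicative ℤ))

instance : IsUltrametricDist (KInf Fq) :=
  IsUltrametricDist.isUltrametricDist_of_forall_norm_add_le_max_norm
    (Valued.isNonarchimedean_norm (KInf Fq) (WithZero (Multiplicative ℤ)))

instance : CompleteSpace (KInf Fq) := inferInstance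

/-- An algebraic closure of `K_∞`. -/
abbrev KInfAlg := AlgebraicClosure (KInf Fq)

instance : NormedField (KInfAlg Fq) := spectralNorm.normedField (KInf Fq) (KInfAlg Fq)

instance : NormedAlgebra (KInf Fq) (KInfAlg Fq) := spectralNorm.normedAlgebra (KInf Fq) (KInfAlg Fq)

instance : IsUltrametricDist (KInfAlg Fq) :=
  IsUltrametricDist.isUltrametricDist_of_forall_norm_add_le_max_norm
    (isNonarchimedean_spectralNorm (K := KInf Fq) (L := KInfAlg Fq))

/-- `ℂ_∞`, the completion of an algebraic closure of `K_∞`. -/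
abbrev CInf := UniformSpace.Completion (KInfAlg Fq)

instance : NormedField (CInf Fq) := inferInstance
instance : CompleteSpace (CInf Fq) := inferInstance
instance : NormedAlgebra (KInf Fq) (CInf Fq) := inferInstance
instance : IsUltrametricDist (CInf Fq) := IsUltrametricDist.of_normedAlgebra (KInf Fq)

/-- The element `θ` of `ℂ_∞`. -/
def theta : CInf Fq := algebraMap (KInf Fq) (CInf Fq) (HahnSeries.single (-1) 1)

theorem norm_theta : ‖theta Fq‖ = Fintype.card Fq := by
  rw [theta, norm_algebraMap', Valued.toNormedField.norm_def]
  have : (Valuation.RankOne.hom (Valued.v : Valuation (KInf Fq) (WithZero (Multiplicative ℤ))))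
      = (WithZeroMulInt.toNNReal (e := (Fintype.card Fq : ℝ≥0)) (by simp)).comp
        MonoidWithZeroHom.ValueGroup₀.embedding := rfl
  rw [this, MonoidWithZeroHom.comp_apply, Valuation.embedding_restrict,
    LaurentSeries.valuation_single_zpow]
  simp [WithZeroMulInt.toNNReal_neg_apply, WithZero.exp]

/-- The inclusion `F_q → ℂ_∞`. -/
def embF : Fq →+* CInf Fq := (algebraMap (KInf Fq) (CInf Fq)).comp HahnSeries.C

/-- The inclusion of `A = F_q[θ]` in `ℂ_∞`; the variable of the polynomial ring is `θ`. -/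
def embA : Polynomial Fq →+* CInf Fq := Polynomial.eval₂RingHom (embF Fq) (theta Fq)

theorem norm_embF (c : Fq) (hc : c ≠ 0) : ‖embF Fq c‖ = 1 := by
  have h : embF Fq c ^ (Fintype.card Fq - 1) = 1 := by
    rw [← map_pow, FiniteField.pow_card_sub_one_eq_one c hc, map_one]
  have h2 := congrArg norm h
  rw [norm_pow, norm_one] at h2
  refine (pow_eq_one_iff_of_nonneg (norm_nonneg _) ?_).1 h2
  have := Fintype.one_lt_card (α := Fq)
  omega

theorem norm_embF_le (c : Fq) : ‖embF Fq c‖ ≤ 1 := by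
  rcases eq_or_ne c 0 with rfl | hc
  · simp
  · exact (norm_embF Fq c hc).le

theorem norm_embA (a : Polynomial Fq) (ha : a.Monic) :
    ‖embA Fq a‖ = (Fintype.card Fq : ℝ) ^ a.natDegree := by
  have hq : (1 : ℝ) < Fintype.card Fq := by exact_mod_cast Fintype.one_lt_card
  obtain ⟨n, hn⟩ : ∃ n, a.natDegree = n := ⟨_, rfl⟩
  rw [embA, Polynomial.coe_eval₂RingHom, Polynomial.eval₂_eq_sum_range, Finset.sum_range_succ,
    ha.coeff_natDegree, map_one, one_mul, hn]
  have hlt : ‖∑ i ∈ Finset.range n, embF Fq (a.coeff i) * theta Fq ^ i‖ < ‖theta Fq ^ n‖ := by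
    rw [norm_pow, norm_theta]
    rcases Nat.eq_zero_or_pos n with rfl | hn0
    · simp
    refine lt_of_le_of_lt (IsUltrametricDist.norm_sum_le_of_forall_le_of_nonneg
      (C := (Fintype.card Fq : ℝ) ^ (n - 1)) (by positivity) fun i hi => ?_)
      (pow_lt_pow_right₀ hq (by omega))
    rw [norm_mul, norm_pow, norm_theta]
    have hi' : i ≤ n - 1 := by have := Finset.mem_range.1 hi; omega
    calc _ ≤ 1 * (Fintype.card Fq : ℝ) ^ (n - 1) := by
            gcongr
            · exact norm_embF_le Fq _
            · exact hq.le
      _ = _ := one_mul _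
  rw [IsUltrametricDist.norm_add_eq_max_of_norm_ne_norm hlt.ne, max_eq_right hlt.le, norm_pow,
    norm_theta]
end CInf

section Entire
variable (Fq : Type*) [Field Fq] [Fintype Fq] (σ : Type*) [Fintype σ]

open Filter Topology

/-- The space `𝔼_Σ` of entire functions `ℂ_∞^σ → ℂ_∞`, as power series in the variables `t_j`,
`j ∈ σ`, that converge on every polydisc: `|f_k| R^{|k|} → 0` as `k → ∞`, for every real `R > 0`. -/
def Entire : Submodule (CInf Fq) (MvPowerSeries σ (CInf Fq)) where
  carrier := {f | ∀ R : ℝ, 0 < R →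
    Tendsto (fun k : σ →₀ ℕ => ‖MvPowerSeries.coeff k f‖ * R ^ k.degree) cofinite (𝓝 0)}
  zero_mem' := fun R hR => by simp [tendsto_const_nhds]
  add_mem' := by
    intro f g hf hg R hR
    refine squeeze_zero (fun k => by positivity) (fun k => ?_)
      (by simpa using (hf R hR).add (hg R hR))
    rw [map_add, ← add_mul]
    gcongr
    exact norm_add_le _ _
  smul_mem' := by
    intro c f hf R hR
    have := (hf R hR).const_mul ‖c‖
    simpa [mul_assoc] using this

variable {Fq σ}


theorem summable_eval (f : Entire Fq σ) (x : σ → CInf Fq) :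
    Summable (fun k : σ →₀ ℕ => MvPowerSeries.coeff k f.1 * ∏ j, x j ^ k j) := by
  apply NonarchimedeanAddGroup.summable_of_tendsto_cofinite_zero
  rw [tendsto_zero_iff_norm_tendsto_zero]
  have hR : 0 < 1 + ∑ j, ‖x j‖ := by positivity
  refine squeeze_zero (fun k => by positivity) (fun k => ?_) (f.2 _ hR)
  rw [norm_mul, norm_prod, Finsupp.degree_eq_sum, ← Finset.prod_pow_eq_pow_sum]
  gcongr with j
  rw [norm_pow]
  gcongr
  have := Finset.single_le_sum (f := fun j => ‖x j‖) (fun j _ => norm_nonneg _) (Finset.mem_univ j)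
  linarith

/-- The value `f(x)` of an entire function, which is linear in `f`. -/
def evalAt (x : σ → CInf Fq) : Entire Fq σ →ₗ[CInf Fq] CInf Fq where
  toFun f := ∑' k : σ →₀ ℕ, MvPowerSeries.coeff k f.1 * ∏ j, x j ^ k j
  map_add' f g := by
    rw [← Summable.tsum_add (summable_eval f x) (summable_eval g x)]
    exact tsum_congr fun k => by rw [Submodule.coe_add, map_add, add_mul]
  map_smul' c f := by
    simp only [RingHom.id_apply, smul_eq_mul]
    rw [← Summable.tsum_mul_left _ (summable_eval f x)]
    exact tsum_congr fun k => by
      rw [Submodule.coe_smul, MvPowerSeries.coeff_smul, mul_assoc]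

end Entire

section XSum
variable {ι σ R : Type*} [Semiring R]

/-- A family of formal series in which every monomial occurs only finitely often, so that the family
has a formal (coefficientwise) sum. -/
def XSummable (g : ι → MvPowerSeries σ R) : Prop :=
  ∀ m, (Function.support fun i => MvPowerSeries.coeff m (g i)).Finite

/-- The formal sum of a family of formal series (meaningful for `XSummable` families). -/
def xSum (g : ι → MvPowerSeries σ R) : MvPowerSeries σ R :=
  fun m => ∑ᶠ i, MvPowerSeries.coeff m (g i)

theorem coeff_xSum (g : ι → MvPowerSeries σ R) (m : σ →₀ ℕ) :
    MvPowerSeries.coeff m (xSum g) = ∑ᶠ i, MvPowerSeries.coeff m (g i) := rfl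

end XSum

section Maps
variable (Fq : Type*) [Field Fq] [Fintype Fq]

/-- `D_i = ∏_{k < i} (θ^{q^i} - θ^{q^k})`. -/
def D (i : ℕ) : CInf Fq :=
  ∏ k ∈ Finset.range i, (theta Fq ^ Fintype.card Fq ^ i - theta Fq ^ Fintype.card Fq ^ k)

theorem mem_Iic_of_pow_le {σ : Type*} {i : σ → ℕ} {m : σ →₀ ℕ}
    (h : ∀ j, Fintype.card Fq ^ i j ≤ m j) : i ∈ Set.Iic (m : σ → ℕ) :=
  fun j => (Nat.lt_pow_self Fintype.one_lt_card).le.trans (h j)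

variable {σ : Type*} [Fintype σ]

/-- The polynomial `B_i(Σ) = ∏_j b_{i_j}(t_j)`, where `b_n(t) = ∏_{k < n} (t - θ^{q^k})`. -/
def B (i : σ → ℕ) : MvPolynomial σ (CInf Fq) :=
  ∏ j, ∏ k ∈ Finset.range (i j),
    (MvPolynomial.X j - MvPolynomial.C (theta Fq ^ Fintype.card Fq ^ k))

/-- The point `(θ^{q^{i_j}})_j` of `ℂ_∞^σ`. -/
def thetaPt (i : σ → ℕ) : σ → CInf Fq := fun j => theta Fq ^ Fintype.card Fq ^ i j

/-- The exponent `(q^{i_j})_j` of the monomial `∏_j X_j^{q^{i_j}}`. -/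
def qPow (i : σ → ℕ) : σ →₀ ℕ :=
  Finsupp.equivFunOnFinite.symm fun j => Fintype.card Fq ^ i j

theorem theta_pow_injective : Function.Injective fun k : ℕ => theta Fq ^ Fintype.card Fq ^ k := by
  intro a b h
  have hq : 1 < Fintype.card Fq := Fintype.one_lt_card
  have h2 := congrArg norm h
  simp only [norm_pow, norm_theta] at h2
  exact Nat.pow_right_injective hq (Nat.pow_right_injective hq (by exact_mod_cast h2))

theorem eval_B_eq_zero {i k : σ → ℕ} (h : ¬ i ≤ k) :
    MvPolynomial.eval (thetaPt Fq k) (B Fq i) = 0 := by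
  obtain ⟨j, hj⟩ := not_forall.1 h
  simp only [B, map_prod, map_sub, MvPolynomial.eval_X, MvPolynomial.eval_C]
  refine Finset.prod_eq_zero (Finset.mem_univ j)
    (Finset.prod_eq_zero (Finset.mem_range.2 (not_le.1 hj)) ?_)
  simp [thetaPt]

theorem eval_B_self_ne_zero (k : σ → ℕ) :
    MvPolynomial.eval (thetaPt Fq k) (B Fq k) ≠ 0 := by
  simp only [B, map_prod, map_sub, MvPolynomial.eval_X, MvPolynomial.eval_C]
  refine Finset.prod_ne_zero_iff.2 fun j _ => Finset.prod_ne_zero_iff.2 fun l hl => ?_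
  refine sub_ne_zero.2 fun h => ?_
  have := theta_pow_injective Fq h
  have := Finset.mem_range.1 hl
  omega

theorem support_finite (k : σ → ℕ) (c : (σ → ℕ) → CInf Fq) :
    (Function.support fun i => c i * MvPolynomial.eval (thetaPt Fq k) (B Fq i)).Finite := by
  classical
  refine (Set.finite_Iic k).subset fun i hi => ?_
  by_contra h
  exact hi (by simp only [eval_B_eq_zero Fq h, mul_zero])

/-- A family of values at the points `θ^{q^k}` is interpolated by exactly one formal combination
`∑_i c_i B_i(Σ)`; its value at `θ^{q^k}` is a finite sum, because `B_i(Σ)` vanishes there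
unless `i ≤ k`. -/
theorem existsUnique_newton (g : (σ → ℕ) → CInf Fq) :
    ∃! c : (σ → ℕ) → CInf Fq, ∀ k,
      ∑ᶠ i, c i * MvPolynomial.eval (thetaPt Fq k) (B Fq i) = g k := by
  classical
  have key : ∀ (c : (σ → ℕ) → CInf Fq) k,
      ∑ᶠ i, c i * MvPolynomial.eval (thetaPt Fq k) (B Fq i) =
      c k * MvPolynomial.eval (thetaPt Fq k) (B Fq k) +
        ∑ i ∈ (Finset.Iio k).attach, c i * MvPolynomial.eval (thetaPt Fq k) (B Fq i) := by
    intro c k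
    rw [finsum_eq_sum_of_support_subset (s := Finset.Iic k), ← Finset.Iio_insert,
      Finset.sum_insert (by simp),
      Finset.sum_attach (Finset.Iio k)
        (fun i => c i * MvPolynomial.eval (thetaPt Fq k) (B Fq i))]
    intro i hi
    by_contra h
    exact hi (by simp only [eval_B_eq_zero Fq (by simpa using h), mul_zero])
  have wf : WellFounded ((· < ·) : (σ → ℕ) → (σ → ℕ) → Prop) := wellFounded_lt
  let F : ∀ k : σ → ℕ, (∀ i, i < k → CInf Fq) → CInf Fq := fun k ih =>
    (g k - ∑ i ∈ (Finset.Iio k).attach, ih i.1 (Finset.mem_Iio.1 i.2) *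
      MvPolynomial.eval (thetaPt Fq k) (B Fq i.1)) / MvPolynomial.eval (thetaPt Fq k) (B Fq k)
  refine ⟨wf.fix F, fun k => ?_, fun c hc => ?_⟩
  · rw [key, wf.fix_eq F k, div_mul_cancel₀ _ (eval_B_self_ne_zero Fq k)]
    ring
  · funext k
    induction k using wf.induction with
    | _ k ih =>
    rw [wf.fix_eq F k, eq_div_iff (eval_B_self_ne_zero Fq k), ← hc k, key c k, eq_sub_iff_add_eq]
    congr 1
    exact Finset.sum_congr rfl fun i _ => by rw [ih i.1 (Finset.mem_Iio.1 i.2)]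

variable {Fq}

/-- The coefficients `f_i` of the unique formal combination `Φ(f) = ∑_i f_i B_i(Σ)` that takes the same
values as the entire function `f` at all the points `θ^{q^k}`. -/
def newtonCoeff (f : Entire Fq σ) : (σ → ℕ) → CInf Fq :=
  (existsUnique_newton Fq fun k => evalAt (thetaPt Fq k) f).choose

theorem newtonCoeff_spec (f : Entire Fq σ) (k : σ → ℕ) :
    ∑ᶠ i, newtonCoeff f i * MvPolynomial.eval (thetaPt Fq k) (B Fq i) =
      evalAt (thetaPt Fq k) f :=
  (existsUnique_newton Fq fun k => evalAt (thetaPt Fq k) f).choose_spec.1 k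

theorem newtonCoeff_unique (f : Entire Fq σ) (c : (σ → ℕ) → CInf Fq)
    (hc : ∀ k, ∑ᶠ i, c i * MvPolynomial.eval (thetaPt Fq k) (B Fq i) =
      evalAt (thetaPt Fq k) f) : c = newtonCoeff f :=
  (existsUnique_newton Fq fun k => evalAt (thetaPt Fq k) f).choose_spec.2 c hc

variable (Fq)

theorem xSummable_qPow (c : (σ → ℕ) → CInf Fq) :
    XSummable fun i => MvPowerSeries.monomial (qPow Fq i) (c i) := by
  classical
  refine fun m => (Set.finite_Iic (m : σ → ℕ)).subset fun i hi => mem_Iic_of_pow_le Fq fun j => ?_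
  rw [Function.mem_support, MvPowerSeries.coeff_monomial] at hi
  have : m = qPow Fq i := by by_contra h; exact hi (if_neg h)
  rw [this]; rfl

/-- The linear map `F_Σ`, which sends `f` to `∑_i f_i ∏_j X_j^{q^{i_j}}`, where the `f_i` are the
coefficients of `Φ(f)`. -/
def mapF : Entire Fq σ →ₗ[CInf Fq] MvPowerSeries σ (CInf Fq) where
  toFun f := xSum fun i => MvPowerSeries.monomial (qPow Fq i) (newtonCoeff f i)
  map_add' f g := by
    have h : newtonCoeff f + newtonCoeff g = newtonCoeff (f + g) := by
      refine newtonCoeff_unique _ _ fun k => ?_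
      simp only [Pi.add_apply, add_mul]
      rw [finsum_add_distrib (support_finite Fq k _) (support_finite Fq k _), newtonCoeff_spec,
        newtonCoeff_spec, map_add]
    ext m
    rw [map_add, coeff_xSum, coeff_xSum, coeff_xSum,
      ← finsum_add_distrib (xSummable_qPow Fq _ m) (xSummable_qPow Fq _ m), ← h]
    simp
  map_smul' c f := by
    have h : c • newtonCoeff f = newtonCoeff (c • f) := by
      refine newtonCoeff_unique _ _ fun k => ?_
      simp only [Pi.smul_apply, smul_eq_mul, mul_assoc]
      rw [← mul_finsum' _ _ (support_finite Fq k _), newtonCoeff_spec, map_smul, smul_eq_mul]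
    ext m
    rw [RingHom.id_apply, MvPowerSeries.coeff_smul, coeff_xSum, coeff_xSum,
      mul_finsum' _ _ (xSummable_qPow Fq _ m), ← h]
    refine finsum_congr fun i => ?_
    rw [Pi.smul_apply, map_smul, MvPowerSeries.coeff_smul]


instance finite_polyLE (d : ℕ) : Finite {a : Polynomial Fq // a.natDegree ≤ d} := by
  refine Finite.of_injective (β := Fin (d + 1) → Fq) (fun a i => a.1.coeff i) fun a b h => ?_
  refine Subtype.ext (Polynomial.ext fun n => ?_)
  rcases Nat.lt_or_ge d n with hn | hn
  · rw [Polynomial.coeff_eq_zero_of_natDegree_lt (a.2.trans_lt hn),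
      Polynomial.coeff_eq_zero_of_natDegree_lt (b.2.trans_lt hn)]
  · exact congrFun h ⟨n, by omega⟩

instance finite_monic (d : ℕ) : Finite {a : Polynomial Fq // a.Monic ∧ a.natDegree = d} :=
  Finite.of_injective (β := {a : Polynomial Fq // a.natDegree ≤ d}) (fun a => ⟨a.1, a.2.2.le⟩)
    fun a b h => Subtype.ext (by simpa using h)

/-- The power sum `S_d(n) = ∑ 1/a^n`, over the monic `a ∈ A` of degree `d`. -/
def powerSum (d n : ℕ) : CInf Fq :=
  ∑ᶠ a : {a : Polynomial Fq // a.Monic ∧ a.natDegree = d}, ((embA Fq a.1) ^ n)⁻¹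

/-- The series `∑_d c_d X_j^{q^d}`. -/
def additiveSeries {τ : Type*} (c : ℕ → CInf Fq) (j : τ) : MvPowerSeries τ (CInf Fq) :=
  xSum fun d => MvPowerSeries.monomial (Finsupp.single j (Fintype.card Fq ^ d)) (c d)

theorem xSummable_additive {τ : Type*} (c : ℕ → CInf Fq) (j : τ) :
    XSummable fun d => MvPowerSeries.monomial (Finsupp.single j (Fintype.card Fq ^ d)) (c d) := by
  classical
  refine fun m => (Set.finite_Iic (m j)).subset fun d hd => ?_
  rw [Function.mem_support, MvPowerSeries.coeff_monomial] at hd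
  have : m = Finsupp.single j (Fintype.card Fq ^ d) := by by_contra h; exact hd (if_neg h)
  rw [this, Finsupp.single_eq_same]
  exact (Nat.lt_pow_self Fintype.one_lt_card).le

theorem X_dvd_additiveSeries {τ : Type*} (c : ℕ → CInf Fq) (j : τ) :
    MvPowerSeries.X j ∣ additiveSeries Fq c j := by
  classical
  refine MvPowerSeries.X_dvd_iff.2 fun m hm => ?_
  rw [additiveSeries, coeff_xSum]
  refine finsum_eq_zero_of_forall_eq_zero fun d => ?_
  rw [MvPowerSeries.coeff_monomial, if_neg]
  rintro rfl
  rw [Finsupp.single_eq_same] at hm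
  exact (pow_ne_zero d Fintype.card_ne_zero) hm

/-- The polylogarithm `λ_A({j}; 1) = ∑_d S_d(1) X_j^{q^d}`. -/
def lam {τ : Type*} (j : τ) : MvPowerSeries τ (CInf Fq) :=
  additiveSeries Fq (fun d => powerSum Fq d 1) j

/-- The coefficients `ℓ_n` of the Carlitz logarithm `log_C = ∑_n ℓ_n X^{q^n}`, the compositional inverse
of the Carlitz exponential `exp_C = ∑_i D_i⁻¹ X^{q^i}`: see `logCoeff_spec`. -/
def logCoeff (n : ℕ) : CInf Fq :=
  (if n = 0 then 1 else 0) -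
    ∑ i : Fin n, (D Fq (i + 1))⁻¹ * logCoeff (n - (i + 1)) ^ Fintype.card Fq ^ ((i : ℕ) + 1)
  decreasing_by omega

/-- The identity `exp_C (log_C X) = X`, coefficient by coefficient. -/
theorem logCoeff_spec (n : ℕ) :
    ∑ i ∈ Finset.range (n + 1), (D Fq i)⁻¹ * logCoeff Fq (n - i) ^ Fintype.card Fq ^ i =
      if n = 0 then 1 else 0 := by
  rw [Finset.sum_range_succ', logCoeff.eq_1 Fq (n - 0), Finset.sum_range]
  simp [D]

/-- The series `log_C(X_j)`. -/
def carlitzLog {τ : Type*} (j : τ) : MvPowerSeries τ (CInf Fq) :=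
  additiveSeries Fq (logCoeff Fq) j

/-- The term of index `i` of the series that defines `E_Σ(f)`. -/
def termE (f : Entire Fq σ) (i : σ → ℕ) : MvPowerSeries σ (CInf Fq) :=
  (evalAt (thetaPt Fq i) f / ∏ j, D Fq (i j)) • ∏ j, lam Fq j ^ Fintype.card Fq ^ i j

theorem xSummable_termE (f : Entire Fq σ) : XSummable (termE Fq f) := by
  classical
  refine fun m => (Set.finite_Iic (m : σ → ℕ)).subset fun i hi => mem_Iic_of_pow_le Fq fun j => ?_
  by_contra h
  refine hi ?_
  have h1 : (MvPowerSeries.X j : MvPowerSeries σ (CInf Fq)) ^ Fintype.card Fq ^ i j ∣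
      ∏ j, lam Fq j ^ Fintype.card Fq ^ i j :=
    (pow_dvd_pow_of_dvd (X_dvd_additiveSeries Fq _ j) _).trans
      (Finset.dvd_prod_of_mem _ (Finset.mem_univ j))
  simp only [termE, MvPowerSeries.coeff_smul, MvPowerSeries.X_pow_dvd_iff.1 h1 m (not_le.1 h),
    mul_zero]

/-- The linear map `E_Σ`, which sends `f` to
`∑_i (f(θ^{q^i}) / D_i) ∏_j λ_A({j}; 1)^{q^{i_j}}`, where `D_i = ∏_j D_{i_j}`. -/
def mapE : Entire Fq σ →ₗ[CInf Fq] MvPowerSeries σ (CInf Fq) where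
  toFun f := xSum (termE Fq f)
  map_add' f g := by
    ext m
    rw [map_add, coeff_xSum, coeff_xSum, coeff_xSum,
      ← finsum_add_distrib (xSummable_termE Fq f m) (xSummable_termE Fq g m)]
    simp only [termE, map_add, add_div, add_smul]
  map_smul' c f := by
    ext m
    rw [RingHom.id_apply, MvPowerSeries.coeff_smul, coeff_xSum, coeff_xSum,
      mul_finsum' _ _ (xSummable_termE Fq f m)]
    simp only [termE, map_smul, smul_eq_mul, mul_div_assoc, mul_smul]

/-- The space of formal series that are `F_q`-linear in each variable `X_j`: only monomials
`∏_j X_j^{q^{d_j}}` occur. -/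
def linSeries (σ : Type*) : Submodule (CInf Fq) (MvPowerSeries σ (CInf Fq)) where
  carrier := {g | ∀ m, MvPowerSeries.coeff m g ≠ 0 → ∀ j, ∃ d, m j = Fintype.card Fq ^ d}
  zero_mem' := fun m hm => absurd (map_zero _) hm
  add_mem' := by
    intro f g hf hg m hm
    by_cases h : MvPowerSeries.coeff m f = 0
    · exact hg m fun h' => hm (by rw [map_add, h, h', add_zero])
    · exact hf m h
  smul_mem' := fun c f hf m hm => hf m fun h => hm (by rw [MvPowerSeries.coeff_smul, h, mul_zero])

/-- The operator `τ` raises the coefficients in `ℂ_∞` to the power `q` and fixes the `t_j`. -/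
def tau (f : MvPowerSeries σ (CInf Fq)) : MvPowerSeries σ (CInf Fq) :=
  fun m => MvPowerSeries.coeff m f ^ Fintype.card Fq

/-- The operator `τ_Σ = ∏_j (t_j - θ) τ`. -/
def tauS (f : MvPowerSeries σ (CInf Fq)) : MvPowerSeries σ (CInf Fq) :=
  (B Fq fun _ : σ => 1 : MvPolynomial σ (CInf Fq)) * tau Fq f

end Maps

section Zeta

/-- Admissible composition arrays: the columns are pairs `(Σ_i, n_i)` of a finite weighted subset
`Σ_i : ℕ+ →₀ ℕ` and an integer `n_i > 0`. The empty list is the unique array of depth `0`. -/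
abbrev CompArray := List ((ℕ+ →₀ ℕ) × ℕ+)

/-- The type `Σ_1 ⋯ Σ_r`, where the product of weighted subsets is the addition of multiplicities. -/
def CompArray.type (C : CompArray) : ℕ+ →₀ ℕ := (C.map Prod.fst).sum

/-- The weight `n_1 + ⋯ + n_r`. -/
def CompArray.weight (C : CompArray) : ℕ := (C.map fun c => (c.2 : ℕ)).sum

/-- The tuples `(a_1, …, a_r)` of monic polynomials with `|a_1| > ⋯ > |a_r|`. -/
def DecTuple (Fq : Type*) [Field Fq] (r : ℕ) : Type _ :=
  {a : Fin r → Polynomial Fq // (∀ i, (a i).Monic) ∧ StrictAnti fun i => (a i).natDegree}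

variable (Fq : Type*) [Field Fq] [Fintype Fq]

/-- The map `a ↦ a(t_j)`. -/
def substVar {σ : Type*} (j : σ) : Polynomial Fq →+* MvPolynomial σ (CInf Fq) :=
  Polynomial.eval₂RingHom (MvPolynomial.C.comp (embF Fq)) (MvPolynomial.X j)

/-- The semi-character `χ_U(a) = ∏_j a(t_j)^{U(j)}`, for `U` supported in `S`. -/
def chi (S : Finset ℕ+) (U : ℕ+ →₀ ℕ) (a : Polynomial Fq) : MvPolynomial S (CInf Fq) :=
  ∏ j : S, substVar Fq j a ^ U j

/-- The term `∏_i χ_{Σ_i}(a_i) / a_i^{n_i}` of the series of a multiple zeta value, for an array whose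
type is supported in `S`. -/
def zetaTerm (S : Finset ℕ+) (C : CompArray) (a : DecTuple Fq C.length) :
    MvPolynomial S (CInf Fq) :=
  ∏ i : Fin C.length,
    ((embA Fq (a.1 i) ^ (C[i].2 : ℕ))⁻¹ • chi Fq S C[i].1 (a.1 i))

/-- The multiple zeta value `ζ_A(C)` in the Tate algebra in the variables `t_j`, `j ∈ S`. The terms tend
to `0` for the Gauss norm (`zetaTerm_tendsto`), so its coefficients are convergent sums. -/
def zeta (S : Finset ℕ+) (C : CompArray) : MvPowerSeries S (CInf Fq) :=
  fun m => ∑' a : DecTuple Fq C.length, MvPolynomial.coeff m (zetaTerm Fq S C a)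

/-- `Z_{n,Σ}`: the `F_p`-vector space generated by the `ζ_A(C)` with `C` admissible of weight `n` and type
the finite subset `S` (its indicator function). Since the characteristic is `p`, the `F_p`-span
of a set is the additive subgroup that it generates. -/
def zetaSpaceWt (S : Finset ℕ+) (n : ℕ) : AddSubgroup (MvPowerSeries S (CInf Fq)) :=
  AddSubgroup.closure {f | ∃ C : CompArray,
    C.type = ∑ j ∈ S, Finsupp.single j 1 ∧ C.weight = n ∧ f = zeta Fq S C}

/-- `Z_Σ = ∑_n Z_{n,Σ}`. -/
def zetaSpace (S : Finset ℕ+) : AddSubgroup (MvPowerSeries S (CInf Fq)) :=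
  ⨆ n, zetaSpaceWt Fq S n

/-- The Gauss norm of `P` is at most `r`. -/
def CoeffLE {σ : Type*} (r : ℝ) (P : MvPolynomial σ (CInf Fq)) : Prop :=
  ∀ m, ‖MvPolynomial.coeff m P‖ ≤ r

variable {Fq} in
theorem CoeffLE.mul {σ : Type*} {r s : ℝ} {P Q : MvPolynomial σ (CInf Fq)} (hr : 0 ≤ r)
    (hs : 0 ≤ s) (hP : CoeffLE Fq r P) (hQ : CoeffLE Fq s Q) : CoeffLE Fq (r * s) (P * Q) := by
  classical
  intro m
  rw [MvPolynomial.coeff_mul]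
  refine IsUltrametricDist.norm_sum_le_of_forall_le_of_nonneg (by positivity) fun x _ => ?_
  rw [norm_mul]
  gcongr
  exacts [hP _, hQ _]

theorem coeffLE_one {σ : Type*} : CoeffLE Fq 1 (1 : MvPolynomial σ (CInf Fq)) := by
  classical
  intro m
  rw [MvPolynomial.coeff_one]
  split_ifs <;> simp

theorem coeffLE_prod {σ ι : Type*} (s : Finset ι) (P : ι → MvPolynomial σ (CInf Fq))
    (r : ι → ℝ) (hr : ∀ i, 0 ≤ r i) (h : ∀ i, CoeffLE Fq (r i) (P i)) :
    CoeffLE Fq (∏ i ∈ s, r i) (∏ i ∈ s, P i) := by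
  classical
  induction s using Finset.induction_on with
  | empty => simpa using coeffLE_one Fq
  | insert i s hi ih =>
    rw [Finset.prod_insert hi, Finset.prod_insert hi]
    exact (h i).mul (hr i) (Finset.prod_nonneg fun i _ => hr i) ih

theorem coeffLE_substVar {σ : Type*} (j : σ) (a : Polynomial Fq) :
    CoeffLE Fq 1 (substVar Fq j a) := by
  classical
  intro m
  rw [substVar, Polynomial.coe_eval₂RingHom, Polynomial.eval₂_eq_sum_range, MvPolynomial.coeff_sum]
  refine IsUltrametricDist.norm_sum_le_of_forall_le_of_nonneg zero_le_one fun n _ => ?_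
  rw [RingHom.comp_apply, MvPolynomial.coeff_C_mul, MvPolynomial.coeff_X_pow]
  split_ifs
  · simpa using norm_embF_le Fq _
  · simp

theorem coeffLE_chi (S : Finset ℕ+) (U : ℕ+ →₀ ℕ) (a : Polynomial Fq) :
    CoeffLE Fq 1 (chi Fq S U a) := by
  have h : ∀ j : S, CoeffLE Fq 1 (substVar Fq j a ^ U j) := fun j => by
    have := coeffLE_prod Fq (Finset.range (U j)) (fun _ => substVar Fq j a) (fun _ => 1)
      (fun _ => zero_le_one) (fun _ => coeffLE_substVar Fq j a)
    simpa using this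
  have := coeffLE_prod Fq Finset.univ (fun j : S => substVar Fq j a ^ U j) (fun _ => 1)
      (fun _ => zero_le_one) h
  rwa [Finset.prod_const_one] at this

/-- The terms of the series tend to zero for the Gauss norm. -/
theorem zetaTerm_tendsto (S : Finset ℕ+) (C : CompArray) (ε : ℝ) (hε : 0 < ε) :
    {a : DecTuple Fq C.length | ¬ CoeffLE Fq ε (zetaTerm Fq S C a)}.Finite := by
  have hq : (1 : ℝ) < Fintype.card Fq := by exact_mod_cast Fintype.one_lt_card
  have hq1 : 1 < Fintype.card Fq := Fintype.one_lt_card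
  obtain ⟨N, hN⟩ := exists_nat_gt (1 / ε)
  have fin : Finite (Fin C.length → {a : Polynomial Fq // a.natDegree ≤ N}) := inferInstance
  have emb : ∀ a ∈ {a : DecTuple Fq C.length | ¬ CoeffLE Fq ε (zetaTerm Fq S C a)},
      ∀ i, (a.1 i).natDegree ≤ N := by
    intro a ha i
    by_contra hlt
    refine ha ?_
    have hb : ∀ i, ‖(embA Fq (a.1 i) ^ (C[i].2 : ℕ))⁻¹‖ ≤
        ((Fintype.card Fq : ℝ) ^ (a.1 i).natDegree)⁻¹ := by
      intro i
      rw [norm_inv, norm_pow, norm_embA Fq _ (a.2.1 i)]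
      refine inv_anti₀ (by positivity) ?_
      exact le_self_pow₀ (one_le_pow₀ hq.le) C[i].2.pos.ne'
    have key := coeffLE_prod Fq Finset.univ
      (fun i : Fin C.length => (embA Fq (a.1 i) ^ (C[i].2 : ℕ))⁻¹ • chi Fq S C[i].1 (a.1 i))
      (fun i => ((Fintype.card Fq : ℝ) ^ (a.1 i).natDegree)⁻¹) (fun i => by positivity)
      (fun i m => by
        rw [MvPolynomial.coeff_smul, smul_eq_mul, norm_mul]
        exact (mul_le_of_le_one_right (norm_nonneg _) (coeffLE_chi Fq S _ _ m)).trans (hb i))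
    refine fun m => (key m).trans ?_
    rw [← Finset.mul_prod_erase _ _ (Finset.mem_univ i)]
    have h1 : ∏ x ∈ Finset.univ.erase i, ((Fintype.card Fq : ℝ) ^ (a.1 x).natDegree)⁻¹ ≤ 1 :=
      Finset.prod_le_one (fun _ _ => by positivity)
        fun x _ => inv_le_one_of_one_le₀ (one_le_pow₀ hq.le)
    refine (mul_le_of_le_one_right (by positivity) h1).trans ?_
    rw [inv_le_comm₀ (by positivity) hε, ← one_div]
    refine hN.le.trans ?_
    have : N ≤ Fintype.card Fq ^ (a.1 i).natDegree :=
      (not_le.1 hlt).le.trans (Nat.lt_pow_self hq1).le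
    exact_mod_cast this
  refine Set.Finite.of_injOn (f := fun a : DecTuple Fq C.length => a.1)
    (t := {b | ∀ i, (b i).natDegree ≤ N}) emb (fun a _ b _ h => Subtype.ext h) ?_
  refine (Set.finite_range fun b : Fin C.length → {a : Polynomial Fq // a.natDegree ≤ N} =>
    fun i => (b i).1).subset fun b hb => ⟨fun i => ⟨b i, hb i⟩, rfl⟩

theorem summable_zetaTerm (S : Finset ℕ+) (C : CompArray) (m : S →₀ ℕ) :
    Summable fun a : DecTuple Fq C.length => MvPolynomial.coeff m (zetaTerm Fq S C a) := by
  apply NonarchimedeanAddGroup.summable_of_tendsto_cofinite_zero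
  rw [NormedAddGroup.tendsto_nhds_zero]
  intro ε hε
  refine (zetaTerm_tendsto Fq S C (ε / 2) (by positivity)).subset fun a ha h => ha ?_
  exact (h m).trans_lt (by linarith)

end Zeta
end TateMZV

end

noncomputable section

namespace TateMZV

/-! ### Frobenius powers of formal series -/

section Frobenius
variable (Fq : Type*) [Field Fq] [Fintype Fq]

/-! Both maps produce only monomials `∏_j X_j^{q^{m_j}}`, so they are compared there. For `mapF` the
coefficient is the Newton coefficient `f_m` by construction. For `mapE`, one first needs Carlitz's
identity `S_d(1) = ℓ_d` (`powerSum_one`), where `ℓ_d` are the coefficients of `log_C`; this is also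
the statement `λ_A = log_C`. Raising to the power `q^i` then shifts the indices, and the coefficient
is `∑_{i ≤ m} f(θ^{q^i}) / D_i ∏_j ℓ_{m_j - i_j}^{q^{i_j}}`. Expanding `f(θ^{q^i}) = ∑_k f_k
B_k(θ^{q^i})` makes the sum over `i` a product over `j`, and in one variable it is the `q^k`-th
power of a coefficient of `exp_C (log_C X) = X`, hence a Kronecker delta (`sum_newton_mul_log`).
Only `f_m` survives.

For `S_d(1) = ℓ_d`, let `e_d(z)` be the coefficient of `X^{q^d}` in `exp_C (z log_C X)`. It is
`F_q`-linear, has degree at most `q^d`, kills all `a` in `A` of degree `< d`, takes the value `1` at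
`θ^d` and has constant derivative `ℓ_d`. Its logarithmic derivative at `θ^d` is the sum of `1/a`
over monic `a` of degree `d`.

The functional equation holds term by term: `D_{n+1} = (θ^{q^{n+1}} - θ) D_n^q` turns the term of
index `i + 1` for `τ_Σ(f)` into the `q`-th power of the term of index `i` for `f`, and the factors
`t_j - θ` kill the remaining terms.

Zeta values are entire because their coefficients decay doubly exponentially (`norm_coeff_zeta_le`).
Grouping tuples by all entries but the leading one produces the sums `∑ χ_U(a) / a^n` over monic `a`
of degree `d`. Up to an error `q^{-q^k}`, `1/a^n` is a constant times `a^{n(q^k-1)}`. Since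
`a^{q^t}` is affine in the coefficients of `a`, the approximating sum is one of a polynomial of low
degree over `F_q^d`, and vanishes as in Chevalley–Warning once `d > nk + |U|`. Small `d` contribute
nothing to a coefficient of large degree. -/

theorem exists_expChar : ∃ p n : ℕ, p.Prime ∧ CharP (CInf Fq) p ∧ Fintype.card Fq = p ^ n := by
  obtain ⟨p, hp⟩ := CharP.exists Fq
  obtain ⟨n, hn, h⟩ := FiniteField.card Fq p
  exact ⟨p, n, hn, charP_of_injective_ringHom (embF Fq).injective p, h⟩

/-- The ring endomorphism `x ↦ x ^ q ^ k` of `ℂ_∞`. -/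
def powHom (k : ℕ) : CInf Fq →+* CInf Fq where
  toFun x := x ^ Fintype.card Fq ^ k
  map_one' := one_pow _
  map_mul' x y := mul_pow x y _
  map_zero' := zero_pow (pow_ne_zero k Fintype.card_ne_zero)
  map_add' x y := by
    obtain ⟨p, n, hp, hc, hn⟩ := exists_expChar Fq
    have := ExpChar.prime (R := CInf Fq) hp
    rw [hn, ← pow_mul]
    exact add_pow_expChar_pow x y p (n * k)

theorem powHom_apply (k : ℕ) (x : CInf Fq) : powHom Fq k x = x ^ Fintype.card Fq ^ k := rfl

theorem continuous_powHom (k : ℕ) : Continuous (powHom Fq k) := continuous_pow _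

theorem embF_pow_card (c : Fq) (k : ℕ) : embF Fq c ^ Fintype.card Fq ^ k = embF Fq c := by
  rw [← map_pow, FiniteField.pow_card_pow]

/-- In characteristic `p`, a `q^k`-th power applies Frobenius to the coefficients and replaces each
`X_j` by `X_j^{q^k}`. -/
theorem coeff_smul_pow_card {σ : Type*} (g : MvPowerSeries σ (CInf Fq)) (m : σ →₀ ℕ) (k : ℕ) :
    MvPowerSeries.coeff (Fintype.card Fq ^ k • m) (g ^ Fintype.card Fq ^ k) =
      MvPowerSeries.coeff m g ^ Fintype.card Fq ^ k := by
  obtain ⟨p, n, hp, hc, hn⟩ := exists_expChar Fq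
  have := ExpChar.prime (R := CInf Fq) hp
  rw [hn, ← pow_mul, ← MvPowerSeries.map_iterateFrobenius_expand p hp.ne_zero g,
    MvPowerSeries.coeff_map, MvPowerSeries.coeff_expand_smul, iterateFrobenius_def]

theorem coeff_pow_card_of_not_dvd {σ : Type*} (g : MvPowerSeries σ (CInf Fq)) {m : σ →₀ ℕ} {k : ℕ}
    {j : σ} (h : ¬ Fintype.card Fq ^ k ∣ m j) :
    MvPowerSeries.coeff m (g ^ Fintype.card Fq ^ k) = 0 := by
  obtain ⟨p, n, hp, hc, hn⟩ := exists_expChar Fq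
  have := ExpChar.prime (R := CInf Fq) hp
  rw [hn, ← pow_mul] at h ⊢
  rw [← MvPowerSeries.map_iterateFrobenius_expand p hp.ne_zero g,
    MvPowerSeries.coeff_map, MvPowerSeries.coeff_expand_of_not_dvd _ _ _ h, map_zero]

theorem exists_eq_smul_of_coeff_pow_card_ne_zero {σ : Type*} (g : MvPowerSeries σ (CInf Fq))
    {m : σ →₀ ℕ} {k : ℕ} (h : MvPowerSeries.coeff m (g ^ Fintype.card Fq ^ k) ≠ 0) :
    ∃ d : σ →₀ ℕ, m = Fintype.card Fq ^ k • d := by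
  have hd : ∀ j, Fintype.card Fq ^ k ∣ m j := fun j => by
    by_contra hj
    exact h (coeff_pow_card_of_not_dvd Fq g hj)
  refine ⟨m.mapRange (fun n => n / Fintype.card Fq ^ k) (Nat.zero_div _), Finsupp.ext fun j => ?_⟩
  simp [Nat.mul_div_cancel' (hd j)]

end Frobenius

/-! ### Additive series and their products -/

section AdditiveSeries
variable (Fq : Type*) [Field Fq] [Fintype Fq]

theorem card_pow_injective : Function.Injective fun k : ℕ => Fintype.card Fq ^ k :=
  Nat.pow_right_injective Fintype.one_lt_card

theorem coeff_additiveSeries_single {τ : Type*} (c : ℕ → CInf Fq) (j : τ) (d : ℕ) :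
    MvPowerSeries.coeff (Finsupp.single j (Fintype.card Fq ^ d)) (additiveSeries Fq c j) = c d := by
  classical
  rw [additiveSeries, coeff_xSum, finsum_eq_single _ d, MvPowerSeries.coeff_monomial, if_pos rfl]
  intro e he
  rw [MvPowerSeries.coeff_monomial, if_neg]
  intro h
  exact he (card_pow_injective Fq (Finsupp.single_injective j h)).symm

theorem exists_eq_single_of_coeff_additiveSeries_ne_zero {τ : Type*} {c : ℕ → CInf Fq} {j : τ}
    {m : τ →₀ ℕ} (h : MvPowerSeries.coeff m (additiveSeries Fq c j) ≠ 0) :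
    ∃ d, m = Finsupp.single j (Fintype.card Fq ^ d) := by
  classical
  by_contra! hm
  refine h ?_
  rw [additiveSeries, coeff_xSum]
  refine finsum_eq_zero_of_forall_eq_zero fun d => ?_
  rw [MvPowerSeries.coeff_monomial, if_neg (hm d)]

/-- Frobenius sends `c_d X^{q^d}` to `c_d^{q^i} X^{q^{d+i}}`, so the new coefficients are shifted by
`i` and vanish below `i`. -/
theorem additiveSeries_pow {τ : Type*} (c : ℕ → CInf Fq) (j : τ) (i : ℕ) :
    additiveSeries Fq c j ^ Fintype.card Fq ^ i =
      additiveSeries Fq (fun d => if i ≤ d then c (d - i) ^ Fintype.card Fq ^ i else 0) j := by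
  have key : ∀ d, MvPowerSeries.coeff (Finsupp.single j (Fintype.card Fq ^ (i + d)))
      (additiveSeries Fq c j ^ Fintype.card Fq ^ i) = c d ^ Fintype.card Fq ^ i := fun d => by
    have := coeff_smul_pow_card Fq (additiveSeries Fq c j)
      (Finsupp.single j (Fintype.card Fq ^ d)) i
    rwa [Finsupp.smul_single, smul_eq_mul, ← pow_add, coeff_additiveSeries_single] at this
  ext m
  by_cases hr : MvPowerSeries.coeff m (additiveSeries Fq
      (fun d => if i ≤ d then c (d - i) ^ Fintype.card Fq ^ i else 0) j) = 0
  · rw [hr]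
    by_contra hl
    obtain ⟨e, rfl⟩ := exists_eq_smul_of_coeff_pow_card_ne_zero Fq _ hl
    have hne := hl
    rw [coeff_smul_pow_card] at hne
    obtain ⟨d, rfl⟩ := exists_eq_single_of_coeff_additiveSeries_ne_zero Fq
      (fun h => hne (by rw [h, zero_pow (pow_ne_zero i Fintype.card_ne_zero)]))
    rw [Finsupp.smul_single, smul_eq_mul, ← pow_add] at hr hl
    rw [coeff_additiveSeries_single, if_pos (by omega), Nat.add_sub_cancel_left] at hr
    exact hl ((key d).trans hr)
  · obtain ⟨d, rfl⟩ := exists_eq_single_of_coeff_additiveSeries_ne_zero Fq hr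
    rw [coeff_additiveSeries_single] at hr ⊢
    have hd : i ≤ d := by by_contra h; exact hr (if_neg h)
    rw [if_pos hd, ← key, Nat.add_sub_cancel' hd]

variable {σ : Type*} [Fintype σ]

theorem qPow_injective : Function.Injective (qPow Fq : (σ → ℕ) → σ →₀ ℕ) := fun _ _ h =>
  funext fun j => card_pow_injective Fq (DFunLike.congr_fun h j)

omit [Field Fq] in
theorem sum_single_eq_qPow (d : σ → ℕ) :
    ∑ j, Finsupp.single j (Fintype.card Fq ^ d j) = qPow Fq d := by
  classical
  ext j
  simp [Finsupp.finsetSum_apply, Finsupp.single_apply, qPow]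

theorem exists_eq_single_of_prod_coeff_ne_zero {c : σ → ℕ → CInf Fq} {m : σ →₀ ℕ}
    {l : σ →₀ σ →₀ ℕ} (hl : ∑ j, l j = m)
    (h : ∏ j, MvPowerSeries.coeff (l j) (additiveSeries Fq (c j) j) ≠ 0) :
    ∃ d, m = qPow Fq d ∧ ∀ j, l j = Finsupp.single j (Fintype.card Fq ^ d j) := by
  choose d hd using fun j => exists_eq_single_of_coeff_additiveSeries_ne_zero Fq
    (Finset.prod_ne_zero_iff.1 h j (Finset.mem_univ j))
  refine ⟨d, ?_, hd⟩
  rw [← hl, ← sum_single_eq_qPow]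
  exact Finset.sum_congr rfl fun j _ => hd j

theorem exists_eq_qPow_of_coeff_prod_ne_zero {c : σ → ℕ → CInf Fq} {m : σ →₀ ℕ}
    (h : MvPowerSeries.coeff m (∏ j, additiveSeries Fq (c j) j) ≠ 0) : ∃ d, m = qPow Fq d := by
  classical
  rw [MvPowerSeries.coeff_prod] at h
  obtain ⟨l, hl, hne⟩ := Finset.exists_ne_zero_of_sum_ne_zero h
  obtain ⟨d, hd, -⟩ :=
    exists_eq_single_of_prod_coeff_ne_zero Fq (Finset.mem_finsuppAntidiag.1 hl).1 hne
  exact ⟨d, hd⟩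

/-- The factors involve distinct variables, so a single term of the antidiagonal sum survives. -/
theorem coeff_qPow_prod_additiveSeries (c : σ → ℕ → CInf Fq) (d : σ → ℕ) :
    MvPowerSeries.coeff (qPow Fq d) (∏ j, additiveSeries Fq (c j) j) = ∏ j, c j (d j) := by
  classical
  rw [MvPowerSeries.coeff_prod, Finset.sum_eq_single
    (Finsupp.equivFunOnFinite.symm fun j => Finsupp.single j (Fintype.card Fq ^ d j))]
  · exact Finset.prod_congr rfl fun j _ => coeff_additiveSeries_single Fq _ _ _
  · intro l hl hne
    by_contra h
    obtain ⟨e, he, hle⟩ :=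
      exists_eq_single_of_prod_coeff_ne_zero Fq (Finset.mem_finsuppAntidiag.1 hl).1 h
    obtain rfl := qPow_injective Fq he
    exact hne (Finsupp.ext hle)
  · intro h
    refine absurd (Finset.mem_finsuppAntidiag.2 ⟨?_, Finset.subset_univ _⟩) h
    exact sum_single_eq_qPow Fq d

end AdditiveSeries

/-! ### Orthogonality from `exp_C (log_C X) = X` -/

section Inversion
variable (Fq : Type*) [Field Fq] [Fintype Fq]

theorem D_ne_zero (i : ℕ) : D Fq i ≠ 0 := by
  refine Finset.prod_ne_zero_iff.2 fun k hk => sub_ne_zero.2 fun h => ?_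
  have := theta_pow_injective Fq h
  have := Finset.mem_range.1 hk
  omega

/-- `D_{n+k} = D_n^{q^k} ∏_{l < k} (θ^{q^{n+k}} - θ^{q^l})`. -/
theorem D_add (n k : ℕ) : D Fq (n + k) =
    (∏ l ∈ Finset.range k, (theta Fq ^ Fintype.card Fq ^ (n + k) - theta Fq ^ Fintype.card Fq ^ l)) *
      D Fq n ^ Fintype.card Fq ^ k := by
  rw [D, add_comm n k, Finset.prod_range_add, ← powHom_apply Fq k (D Fq n), D, map_prod]
  congr 1
  refine Finset.prod_congr rfl fun l _ => ?_
  rw [map_sub, powHom_apply, powHom_apply, ← pow_mul, ← pow_mul, ← pow_add, ← pow_add,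
    add_comm n k, add_comm l k]

theorem D_succ (n : ℕ) : D Fq (n + 1) =
    (theta Fq ^ Fintype.card Fq ^ (n + 1) - theta Fq) * D Fq n ^ Fintype.card Fq := by
  simpa using D_add Fq n 1

/-- The product over `l` vanishes for `i < k`. For `i ≥ k`, `D_add` shows that its quotient by `D_i`
is `D_{i-k}^{-q^k}`, so the sum is the `q^k`-th power of the identity `logCoeff_spec` at `m - k`. -/
theorem sum_newton_mul_log (k m : ℕ) (hkm : k ≤ m) :
    ∑ i ∈ Finset.Iic m,
      (∏ l ∈ Finset.range k, (theta Fq ^ Fintype.card Fq ^ i - theta Fq ^ Fintype.card Fq ^ l)) /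
        D Fq i * logCoeff Fq (m - i) ^ Fintype.card Fq ^ i = if k = m then 1 else 0 := by
  obtain ⟨n, rfl⟩ := Nat.exists_eq_add_of_le hkm
  have hI : Finset.Iic (k + n) = Finset.range (k + (n + 1)) := by
    ext; simp; omega
  rw [hI, Finset.sum_range_add, Finset.sum_eq_zero, zero_add]
  · have := congrArg (powHom Fq k) (logCoeff_spec Fq n)
    rw [map_sum] at this
    have hr : (powHom Fq k) (if n = 0 then 1 else 0) = if k = k + n then 1 else 0 := by
      by_cases h : n = 0 <;> simp [h]
    rw [hr] at this
    rw [← this]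
    refine Finset.sum_congr rfl fun i _ => ?_
    have hD := D_ne_zero Fq (i + k)
    rw [D_add] at hD
    rw [add_comm k i, D_add, ← div_div, div_self (left_ne_zero_of_mul hD), one_div, map_mul,
      map_inv₀, powHom_apply, powHom_apply, ← pow_mul, ← pow_add, show n - i = k + n - (i + k) by omega]
  · intro i hi
    rw [Finset.prod_eq_zero (Finset.mem_range.2 (Finset.mem_range.1 hi)) (sub_self _), zero_div,
      zero_mul]

end Inversion

/-! ### Carlitz polynomials and the power sums `S_d(1)` -/

section Interpolation
variable (Fq : Type*) [Field Fq] [Fintype Fq]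

open Polynomial

/-- The polynomial `∑_{i ≤ d} D_i⁻¹ ℓ_{d-i}^{q^i} z^{q^i}`: the coefficient of `X^{q^d}` in
`exp_C (z log_C X)`. -/
def carlitzPoly (d : ℕ) : (CInf Fq)[X] :=
  ∑ i ∈ Finset.range (d + 1),
    C ((D Fq i)⁻¹ * logCoeff Fq (d - i) ^ Fintype.card Fq ^ i) * X ^ Fintype.card Fq ^ i

theorem eval_carlitzPoly (d : ℕ) (z : CInf Fq) : (carlitzPoly Fq d).eval z =
    ∑ i ∈ Finset.range (d + 1),
      (D Fq i)⁻¹ * logCoeff Fq (d - i) ^ Fintype.card Fq ^ i * z ^ Fintype.card Fq ^ i := by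
  simp [carlitzPoly, eval_finsetSum]

theorem eval_carlitzPoly_one (d : ℕ) :
    (carlitzPoly Fq d).eval 1 = if d = 0 then 1 else 0 := by
  rw [eval_carlitzPoly, ← logCoeff_spec Fq d]
  simp

theorem eval_carlitzPoly_add (d : ℕ) (x y : CInf Fq) :
    (carlitzPoly Fq d).eval (x + y) = (carlitzPoly Fq d).eval x + (carlitzPoly Fq d).eval y := by
  simp only [eval_carlitzPoly, ← powHom_apply, map_add, mul_add, Finset.sum_add_distrib]

theorem eval_carlitzPoly_embF_mul (d : ℕ) (c : Fq) (x : CInf Fq) :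
    (carlitzPoly Fq d).eval (embF Fq c * x) = embF Fq c * (carlitzPoly Fq d).eval x := by
  simp only [eval_carlitzPoly, mul_pow, embF_pow_card, Finset.mul_sum]
  exact Finset.sum_congr rfl fun i _ => by ring

theorem eval_carlitzPoly_sum {ι : Type*} (s : Finset ι) (d : ℕ) (f : ι → CInf Fq) :
    (carlitzPoly Fq d).eval (∑ i ∈ s, f i) = ∑ i ∈ s, (carlitzPoly Fq d).eval (f i) :=
  map_sum (AddMonoidHom.mk' (fun x => (carlitzPoly Fq d).eval x) (eval_carlitzPoly_add Fq d)) f s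

/-- The coefficientwise form of `exp_C (θ w) = θ exp_C w + (exp_C w)^q`. -/
theorem eval_carlitzPoly_theta_mul_succ (d : ℕ) (z : CInf Fq) :
    (carlitzPoly Fq (d + 1)).eval (theta Fq * z) = theta Fq * (carlitzPoly Fq (d + 1)).eval z +
      (carlitzPoly Fq d).eval z ^ Fintype.card Fq := by
  rw [eval_carlitzPoly, eval_carlitzPoly, Finset.sum_range_succ', Finset.sum_range_succ' _ (d + 1),
    eval_carlitzPoly]
  have h1 : ∀ x : CInf Fq, x ^ Fintype.card Fq = powHom Fq 1 x := fun x => by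
    rw [powHom_apply, pow_one]
  rw [h1, map_sum, mul_add, Finset.mul_sum, add_right_comm, ← Finset.sum_add_distrib]
  congr 1
  -- The terms of index `i + 1` match because `(θ^{q^{i+1}} - θ) / D_{i+1} = D_i^{-q}`.
  · refine Finset.sum_congr rfl fun i _ => ?_
    have hD := D_ne_zero Fq (i + 1)
    rw [D_succ] at hD ⊢
    have ha := left_ne_zero_of_mul hD
    have hb := right_ne_zero_of_mul hD
    rw [Nat.add_sub_add_right, map_mul, map_mul, map_inv₀]
    simp only [powHom_apply, pow_one, ← pow_mul, ← pow_succ, mul_pow, mul_inv]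
    field_simp
    ring
  · simp
    ring

/-- The value at `1` is a coefficient of `exp_C (log_C X) = X`. In the inductive step the term
multiplied by `θ` vanishes because `n < d + 1`, which lowers `n` and `d` together. -/
theorem eval_carlitzPoly_theta_pow {d n : ℕ} (h : n ≤ d) :
    (carlitzPoly Fq d).eval (theta Fq ^ n) = if n = d then 1 else 0 := by
  induction n generalizing d with
  | zero => rw [pow_zero, eval_carlitzPoly_one]; simp [eq_comm]
  | succ n ih =>
    obtain ⟨d, rfl⟩ : ∃ e, d = e + 1 := ⟨d - 1, by omega⟩
    rw [pow_succ', eval_carlitzPoly_theta_mul_succ, ih (by omega), ih (by omega),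
      if_neg (by omega), mul_zero, zero_add]
    by_cases hd : n = d <;> simp [hd]

theorem eval_carlitzPoly_embA {d : ℕ} {a : Fq[X]} (ha : a.natDegree ≤ d) :
    (carlitzPoly Fq d).eval (embA Fq a) = embF Fq (a.coeff d) := by
  rw [embA, coe_eval₂RingHom, eval₂_eq_sum_range' (embF Fq) (Nat.lt_succ_of_le ha),
    eval_carlitzPoly_sum, Finset.sum_eq_single d]
  · rw [eval_carlitzPoly_embF_mul, eval_carlitzPoly_theta_pow Fq le_rfl, if_pos rfl, mul_one]
  · intro i hi hne
    rw [eval_carlitzPoly_embF_mul, eval_carlitzPoly_theta_pow Fq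
      (Nat.lt_succ_iff.1 (Finset.mem_range.1 hi)), if_neg hne, mul_zero]
  · simp

theorem embA_ne_zero {a : Fq[X]} (ha : a ≠ 0) : embA Fq a ≠ 0 := by
  have h : (a * C a.leadingCoeff⁻¹).Monic := monic_mul_leadingCoeff_inv ha
  intro h0
  have h1 := norm_embA Fq _ h
  rw [map_mul, h0, zero_mul, norm_zero] at h1
  exact (pow_ne_zero _ (Nat.cast_ne_zero.2 Fintype.card_ne_zero)) h1.symm

theorem embA_injective : Function.Injective (embA Fq) :=
  (injective_iff_map_eq_zero _).2 fun a h => by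
    by_contra ha
    exact embA_ne_zero Fq ha h

theorem natDegree_carlitzPoly_le (d : ℕ) : (carlitzPoly Fq d).natDegree ≤ Fintype.card Fq ^ d := by
  refine natDegree_sum_le_of_forall_le _ _ fun i hi => (natDegree_C_mul_X_pow_le _ _).trans ?_
  exact Nat.pow_le_pow_right Fintype.card_pos (Nat.lt_succ_iff.1 (Finset.mem_range.1 hi))

theorem carlitzPoly_ne_zero (d : ℕ) : carlitzPoly Fq d ≠ 0 := fun h => by
  have := eval_carlitzPoly_theta_pow Fq (le_refl d)
  simp [h] at this

/-- All exponents except `q^0` are divisible by `p`. -/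
theorem derivative_carlitzPoly (d : ℕ) :
    derivative (carlitzPoly Fq d) = C (logCoeff Fq d) := by
  have hq : ∀ i, ((Fintype.card Fq ^ (i + 1) : ℕ) : CInf Fq) = 0 := fun i => by
    obtain ⟨p, n, hp, hc, hn⟩ := exists_expChar Fq
    have hn0 : n ≠ 0 := by
      rintro rfl
      exact Fintype.one_lt_card.ne' (hn.trans (pow_zero p))
    rw [CharP.cast_eq_zero_iff _ p, hn, ← pow_mul]
    exact dvd_pow_self _ (by simp [hn0])
  rw [carlitzPoly, derivative_sum, Finset.sum_range_succ', Finset.sum_eq_zero]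
  · simp [D]
  · intro i _
    rw [derivative_C_mul_X_pow, hq, mul_zero, C_0, zero_mul]

instance (d : ℕ) : Finite (degreeLT Fq d) := Finite.of_equiv _ (degreeLTEquiv Fq d).symm.toEquiv

instance (d : ℕ) : Fintype (degreeLT Fq d) := Fintype.ofFinite _

theorem card_degreeLT (d : ℕ) : Fintype.card (degreeLT Fq d) = Fintype.card Fq ^ d := by
  rw [Fintype.card_congr (degreeLTEquiv Fq d).toEquiv, Fintype.card_fun, Fintype.card_fin]

/-- There are already `q^d` distinct roots in `A`, and the degree is at most `q^d`. The sign makes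
`θ^d` minus a root run through the monic polynomials of degree `d`. -/
theorem roots_carlitzPoly (d : ℕ) : (carlitzPoly Fq d).roots =
    (Finset.univ.val : Multiset (degreeLT Fq d)).map fun a => -embA Fq a.1 := by
  have hinj : Function.Injective fun a : degreeLT Fq d => -embA Fq a.1 := fun a b h =>
    Subtype.ext (embA_injective Fq (neg_injective h))
  symm
  refine Multiset.eq_of_le_of_card_le ?_ ?_
  · refine (Multiset.le_iff_subset (Finset.univ.nodup.map hinj)).2 fun x hx => ?_
    obtain ⟨a, -, rfl⟩ := Multiset.mem_map.1 hx
    rw [mem_roots (carlitzPoly_ne_zero Fq d), IsRoot, ← map_neg,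
      eval_carlitzPoly_embA, coeff_neg, coeff_eq_zero_of_degree_lt (mem_degreeLT.1 a.2)]
    · simp
    · rw [natDegree_neg]
      exact natDegree_le_of_degree_le (mem_degreeLT.1 a.2).le
  · rw [Multiset.card_map, Finset.card_val, Finset.card_univ, card_degreeLT]
    exact (card_roots' _).trans (natDegree_carlitzPoly_le Fq d)

theorem splits_carlitzPoly (d : ℕ) : (carlitzPoly Fq d).Splits := by
  rw [splits_iff_card_roots]
  refine le_antisymm (card_roots' _) ((natDegree_carlitzPoly_le Fq d).trans ?_)
  rw [roots_carlitzPoly, Multiset.card_map, Finset.card_val, Finset.card_univ, card_degreeLT]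

theorem finsum_monic {R : Type*} [AddCommMonoid R] (d : ℕ) (F : Fq[X] → R) :
    ∑ᶠ a : {a : Fq[X] // a.Monic ∧ a.natDegree = d}, F a.1 =
      ∑ a : degreeLT Fq d, F (X ^ d + a.1) := by
  rw [← finsum_eq_sum_of_fintype, ← finsum_comp_equiv (monicEquivDegreeLT d).symm]
  rfl

/-- Carlitz's evaluation of the power sums `S_d(1)`: the coefficients of the Carlitz logarithm. -/
theorem powerSum_one (d : ℕ) : powerSum Fq d 1 = logCoeff Fq d := by
  have h1 : (carlitzPoly Fq d).eval (theta Fq ^ d) = 1 := by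
    rw [eval_carlitzPoly_theta_pow Fq le_rfl, if_pos rfl]
  -- For a split polynomial, `P'(x) = P(x) ∑ 1/(x - root)`; here `P' = ℓ_d` and `P(θ^d) = 1`.
  have h := (splits_carlitzPoly Fq d).eval_derivative_eq_eval_mul_sum
    (x := theta Fq ^ d) (by rw [h1]; exact one_ne_zero)
  rw [derivative_carlitzPoly, eval_C, h1, one_mul, roots_carlitzPoly, Multiset.map_map] at h
  rw [h, powerSum, finsum_monic Fq d fun a => ((embA Fq a) ^ 1)⁻¹]
  refine Finset.sum_congr rfl fun a _ => ?_
  simp [embA]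

theorem lam_eq_carlitzLog {τ : Type*} (j : τ) : lam Fq j = carlitzLog Fq j := by
  rw [lam, carlitzLog, funext (powerSum_one Fq)]

end Interpolation

/-! ### Equality of the two maps -/

section Comparison
variable {Fq : Type*} [Field Fq] [Fintype Fq] {σ : Type*} [Fintype σ]

theorem coeff_mapF_qPow (f : Entire Fq σ) (d : σ → ℕ) :
    MvPowerSeries.coeff (qPow Fq d) (mapF Fq f) = newtonCoeff f d := by
  classical
  change MvPowerSeries.coeff (qPow Fq d) (xSum _) = _
  rw [coeff_xSum, finsum_eq_single _ d, MvPowerSeries.coeff_monomial, if_pos rfl]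
  intro e he
  rw [MvPowerSeries.coeff_monomial, if_neg]
  intro h
  exact he (qPow_injective Fq h).symm

theorem exists_eq_qPow_of_coeff_mapF_ne_zero {f : Entire Fq σ} {m : σ →₀ ℕ}
    (h : MvPowerSeries.coeff m (mapF Fq f) ≠ 0) : ∃ d, m = qPow Fq d := by
  classical
  by_contra! hm
  refine h ?_
  change MvPowerSeries.coeff m (xSum _) = _
  rw [coeff_xSum]
  refine finsum_eq_zero_of_forall_eq_zero fun d => ?_
  rw [MvPowerSeries.coeff_monomial, if_neg (hm d)]

theorem mapF_mem_linSeries (f : Entire Fq σ) : mapF Fq f ∈ linSeries Fq σ := by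
  intro m hm j
  obtain ⟨d, rfl⟩ := exists_eq_qPow_of_coeff_mapF_ne_zero hm
  exact ⟨d j, rfl⟩

theorem termE_eq (f : Entire Fq σ) (i : σ → ℕ) :
    termE Fq f i = (evalAt (thetaPt Fq i) f / ∏ j, D Fq (i j)) • ∏ j, additiveSeries Fq
      (fun d => if i j ≤ d then logCoeff Fq (d - i j) ^ Fintype.card Fq ^ i j else 0) j := by
  simp only [termE, lam_eq_carlitzLog, carlitzLog, additiveSeries_pow]

theorem exists_eq_qPow_of_coeff_mapE_ne_zero {f : Entire Fq σ} {m : σ →₀ ℕ}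
    (h : MvPowerSeries.coeff m (mapE Fq f) ≠ 0) : ∃ d, m = qPow Fq d := by
  by_contra! hm
  refine h ?_
  change MvPowerSeries.coeff m (xSum _) = _
  rw [coeff_xSum]
  refine finsum_eq_zero_of_forall_eq_zero fun i => ?_
  rw [termE_eq, MvPowerSeries.coeff_smul]
  by_contra hne
  obtain ⟨d, hd⟩ := exists_eq_qPow_of_coeff_prod_ne_zero Fq (right_ne_zero_of_mul hne)
  exact hm d hd

theorem eval_B (i k : σ → ℕ) : MvPolynomial.eval (thetaPt Fq i) (B Fq k) =
    ∏ j, ∏ l ∈ Finset.range (k j),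
      (theta Fq ^ Fintype.card Fq ^ i j - theta Fq ^ Fintype.card Fq ^ l) := by
  simp [B, thetaPt]

/-- The Newton expansion is taken over the box `k ≤ m`, independent of `i`, so that the sums over
`i` and `k` can be exchanged. -/
theorem evalAt_thetaPt (f : Entire Fq σ) {i m : σ → ℕ} (h : i ≤ m) [DecidableEq σ] :
    evalAt (thetaPt Fq i) f = ∑ k ∈ Finset.Iic m, newtonCoeff f k *
      MvPolynomial.eval (thetaPt Fq i) (B Fq k) := by
  rw [← newtonCoeff_spec f i]
  refine finsum_eq_sum_of_support_subset _ fun k hk => ?_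
  rw [Finset.coe_Iic, Set.mem_Iic]
  refine le_trans ?_ h
  by_contra hki
  exact hk (by simp only [eval_B_eq_zero Fq hki, mul_zero])

theorem sum_Iic_prod {R : Type*} [CommSemiring R] [DecidableEq σ] (m : σ → ℕ)
    (F : σ → ℕ → R) :
    ∑ i ∈ Finset.Iic m, ∏ j, F j (i j) = ∏ j, ∑ n ∈ Finset.Iic (m j), F j n := by
  rw [Finset.prod_univ_sum, show Finset.Iic m = Fintype.piFinset fun j => Finset.Iic (m j) by
    ext; simp [Pi.le_def]]

theorem sum_prod_newton_mul_log [DecidableEq σ] {k m : σ → ℕ} (hkm : k ≤ m) :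
    ∑ i ∈ Finset.Iic m, ∏ j, ((∏ l ∈ Finset.range (k j),
      (theta Fq ^ Fintype.card Fq ^ i j - theta Fq ^ Fintype.card Fq ^ l)) / D Fq (i j) *
        logCoeff Fq (m j - i j) ^ Fintype.card Fq ^ i j) = if k = m then 1 else 0 := by
  rw [sum_Iic_prod m fun j n => (∏ l ∈ Finset.range (k j),
      (theta Fq ^ Fintype.card Fq ^ n - theta Fq ^ Fintype.card Fq ^ l)) / D Fq n *
        logCoeff Fq (m j - n) ^ Fintype.card Fq ^ n,
    Finset.prod_congr rfl fun j _ => sum_newton_mul_log Fq (k j) (m j) (hkm j)]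
  split_ifs with h
  · simp [h]
  · obtain ⟨j, hj⟩ := Function.ne_iff.1 h
    exact Finset.prod_eq_zero (Finset.mem_univ j) (if_neg hj)

theorem coeff_mapE_qPow (f : Entire Fq σ) (m : σ → ℕ) :
    MvPowerSeries.coeff (qPow Fq m) (mapE Fq f) = newtonCoeff f m := by
  classical
  change MvPowerSeries.coeff (qPow Fq m) (xSum _) = _
  have hterm : ∀ i, MvPowerSeries.coeff (qPow Fq m) (termE Fq f i) =
      evalAt (thetaPt Fq i) f / (∏ j, D Fq (i j)) *
        ∏ j, if i j ≤ m j then logCoeff Fq (m j - i j) ^ Fintype.card Fq ^ i j else 0 := fun i => by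
    rw [termE_eq, MvPowerSeries.coeff_smul, coeff_qPow_prod_additiveSeries]
  rw [coeff_xSum, finsum_eq_sum_of_support_subset (s := Finset.Iic m)]
  · have hin : ∀ i ∈ Finset.Iic m, MvPowerSeries.coeff (qPow Fq m) (termE Fq f i) =
        ∑ k ∈ Finset.Iic m, newtonCoeff f k * ∏ j, ((∏ l ∈ Finset.range (k j),
          (theta Fq ^ Fintype.card Fq ^ i j - theta Fq ^ Fintype.card Fq ^ l)) / D Fq (i j) *
            logCoeff Fq (m j - i j) ^ Fintype.card Fq ^ i j) := fun i hi => by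
      have hi' := Finset.mem_Iic.1 hi
      rw [hterm, evalAt_thetaPt f hi', Finset.sum_div, Finset.sum_mul]
      refine Finset.sum_congr rfl fun k _ => ?_
      rw [eval_B, Finset.prod_mul_distrib, Finset.prod_div_distrib,
        Finset.prod_congr rfl fun j _ => if_pos (hi' j)]
      ring
    -- After the exchange, the inner sum over `i` is the orthogonality relation, which isolates `k =
    -- m`.
    rw [Finset.sum_congr rfl hin, Finset.sum_comm, Finset.sum_eq_single m]
    · rw [← Finset.mul_sum, sum_prod_newton_mul_log le_rfl, if_pos rfl, mul_one]
    · intro k hk hne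
      rw [← Finset.mul_sum, sum_prod_newton_mul_log (Finset.mem_Iic.1 hk), if_neg hne, mul_zero]
    · simp
  · intro i hi
    rw [Finset.coe_Iic, Set.mem_Iic]
    by_contra h
    obtain ⟨j, hj⟩ := not_forall.1 h
    exact hi (by
      change MvPowerSeries.coeff (qPow Fq m) (termE Fq f i) = 0
      rw [hterm]
      exact mul_eq_zero_of_right _ (Finset.prod_eq_zero (Finset.mem_univ j) (if_neg hj)))

theorem mapE_eq_mapF : (mapE Fq : Entire Fq σ →ₗ[CInf Fq] MvPowerSeries σ (CInf Fq)) = mapF Fq := by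
  refine LinearMap.ext fun f => MvPowerSeries.ext fun m => ?_
  by_cases hm : ∃ d, m = qPow Fq d
  · obtain ⟨d, rfl⟩ := hm
    rw [coeff_mapE_qPow, coeff_mapF_qPow]
  · rw [not_imp_comm.1 exists_eq_qPow_of_coeff_mapE_ne_zero hm,
      not_imp_comm.1 exists_eq_qPow_of_coeff_mapF_ne_zero hm]

end Comparison

/-! ### The operator `τ_Σ` and the functional equation -/

section FunctionalEquation
variable {Fq : Type*} [Field Fq] [Fintype Fq] {σ : Type*} [Fintype σ]

open Filter Topology

omit [Fintype σ] in
theorem tau_mem_entire {f : MvPowerSeries σ (CInf Fq)} (hf : f ∈ Entire Fq σ) :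
    tau Fq f ∈ Entire Fq σ := by
  have hq : Fintype.card Fq ≠ 0 := Fintype.card_ne_zero
  intro R hR
  -- Convergence at radius `max R 1`, raised to the power `q`, controls `R^{|k|}` since `R^{|k|} ≤
  -- (max R 1)^{q|k|}`.
  have hR1 : 0 < max R 1 := by positivity
  have h := (hf _ hR1).pow (Fintype.card Fq)
  rw [zero_pow hq] at h
  refine squeeze_zero (fun k => by positivity) (fun k => ?_) h
  change ‖MvPowerSeries.coeff k f ^ Fintype.card Fq‖ * _ ≤ _
  rw [norm_pow, mul_pow, ← pow_mul]
  gcongr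
  calc R ^ k.degree ≤ max R 1 ^ k.degree := by gcongr; exact le_max_left _ _
    _ ≤ _ := pow_le_pow_right₀ (le_max_right _ _) (Nat.le_mul_of_pos_right _ (by omega))

theorem evalAt_eq (x : σ → CInf Fq) (f : Entire Fq σ) :
    evalAt x f = ∑' k : σ →₀ ℕ, MvPowerSeries.coeff k f.1 * ∏ j, x j ^ k j := rfl

/-- Frobenius is a continuous ring endomorphism, so it passes through the convergent sum. -/
theorem evalAt_tau (f : Entire Fq σ) (x : σ → CInf Fq) :
    evalAt (fun j => x j ^ Fintype.card Fq) ⟨tau Fq f.1, tau_mem_entire f.2⟩ =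
      evalAt x f ^ Fintype.card Fq := by
  have h := ((summable_eval f x).hasSum.map (powHom Fq 1) (continuous_powHom Fq 1)).tsum_eq
  rw [powHom_apply, pow_one] at h
  rw [evalAt_eq, evalAt_eq, ← h]
  refine tsum_congr fun k => ?_
  rw [Function.comp_apply, map_mul, map_prod]
  simp only [powHom_apply, pow_one, ← pow_mul, mul_comm (Fintype.card Fq)]
  rfl

theorem tendsto_cofinite_of_comp {α β : Type*} {e : α → β}
    {g : β → ℝ} (h0 : ∀ b ∉ Set.range e, g b = 0) (h : Tendsto (g ∘ e) cofinite (𝓝 0)) :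
    Tendsto g cofinite (𝓝 0) := by
  refine fun s hs => mem_cofinite.2 ?_
  refine ((mem_cofinite.1 (h hs)).image e).subset fun b hb => ?_
  by_cases hbe : b ∈ Set.range e
  · obtain ⟨a, rfl⟩ := hbe
    exact ⟨a, hb, rfl⟩
  · exact absurd (by rw [Set.mem_preimage, h0 b hbe]; exact mem_of_mem_nhds hs) hb

omit [Fintype σ] in
theorem coeff_monomial_mul_eq_zero (n : σ →₀ ℕ) (a : CInf Fq) (f : MvPowerSeries σ (CInf Fq))
    {m : σ →₀ ℕ} (hm : m ∉ Set.range fun k => n + k) :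
    MvPowerSeries.coeff m (MvPowerSeries.monomial n a * f) = 0 := by
  classical
  rw [MvPowerSeries.coeff_monomial_mul, if_neg]
  exact fun h => hm ⟨m - n, add_tsub_cancel_of_le h⟩

omit [Fintype σ] in
theorem monomial_mul_mem_entire {f : MvPowerSeries σ (CInf Fq)} (hf : f ∈ Entire Fq σ)
    (n : σ →₀ ℕ) (a : CInf Fq) : MvPowerSeries.monomial n a * f ∈ Entire Fq σ := by
  intro R hR
  refine tendsto_cofinite_of_comp (e := fun k => n + k) (fun m hm => ?_) ?_
  · rw [coeff_monomial_mul_eq_zero n a f hm, norm_zero, zero_mul]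
  · have h := (hf R hR).const_mul (‖a‖ * R ^ n.degree)
    rw [mul_zero] at h
    refine h.congr fun k => ?_
    rw [Function.comp_apply, MvPowerSeries.coeff_add_monomial_mul, norm_mul, map_add, pow_add]
    ring

theorem evalAt_monomial_mul (f : Entire Fq σ) (n : σ →₀ ℕ) (a : CInf Fq) (x : σ → CInf Fq) :
    evalAt x ⟨MvPowerSeries.monomial n a * f.1, monomial_mul_mem_entire f.2 n a⟩ =
      a * (∏ j, x j ^ n j) * evalAt x f := by
  rw [evalAt_eq, evalAt_eq, ← Summable.tsum_mul_left _ (summable_eval f x),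
    ← (add_right_injective n).tsum_eq]
  · refine tsum_congr fun k => ?_
    simp only [MvPowerSeries.coeff_add_monomial_mul, Finsupp.add_apply, pow_add,
      Finset.prod_mul_distrib]
    ring
  · intro m hm
    by_contra h
    exact hm (by
      change MvPowerSeries.coeff m (MvPowerSeries.monomial n a * f.1) * _ = 0
      rw [coeff_monomial_mul_eq_zero n a f.1 h, zero_mul])

theorem exists_evalAt_mul (f : Entire Fq σ) (P : MvPolynomial σ (CInf Fq)) :
    ∃ h : (P : MvPowerSeries σ (CInf Fq)) * f.1 ∈ Entire Fq σ,
      ∀ x, evalAt x ⟨_, h⟩ = MvPolynomial.eval x P * evalAt x f := by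
  induction P using MvPolynomial.induction_on' with
  | monomial n a =>
    refine ⟨?_, fun x => ?_⟩
    · rw [MvPolynomial.coe_monomial]
      exact monomial_mul_mem_entire f.2 n a
    · simp only [MvPolynomial.coe_monomial]
      rw [evalAt_monomial_mul, MvPolynomial.eval_monomial, Finsupp.prod_fintype _ _ (by simp)]
  | add P Q hP hQ =>
    obtain ⟨h1, hP⟩ := hP
    obtain ⟨h2, hQ⟩ := hQ
    have h : ((P + Q : MvPolynomial σ (CInf Fq)) : MvPowerSeries σ (CInf Fq)) * f.1 =
        (P : MvPowerSeries σ (CInf Fq)) * f.1 + (Q : MvPowerSeries σ (CInf Fq)) * f.1 := by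
      rw [MvPolynomial.coe_add, add_mul]
    refine ⟨h ▸ add_mem h1 h2, fun x => ?_⟩
    rw [map_add, add_mul, ← hP, ← hQ, ← map_add]
    exact congrArg _ (Subtype.ext h)

theorem tauS_mem_entire (f : Entire Fq σ) : tauS Fq f.1 ∈ Entire Fq σ :=
  (exists_evalAt_mul ⟨_, tau_mem_entire f.2⟩ _).1

theorem evalAt_tauS (f : Entire Fq σ) (x : σ → CInf Fq) :
    evalAt x ⟨tauS Fq f.1, tauS_mem_entire f⟩ =
      (∏ j, (x j - theta Fq)) * evalAt x ⟨tau Fq f.1, tau_mem_entire f.2⟩ := by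
  refine ((exists_evalAt_mul ⟨_, tau_mem_entire f.2⟩ _).2 x).trans ?_
  simp [B]

omit [Fintype σ] in
theorem thetaPt_add_one (i : σ → ℕ) :
    thetaPt Fq (i + 1) = fun j => thetaPt Fq i j ^ Fintype.card Fq := by
  funext j
  rw [thetaPt, thetaPt, ← pow_mul, ← pow_succ]
  rfl

/-- The factor `∏_j (θ^{q^{i_j+1}} - θ)` coming from `τ_Σ` is exactly what `D_{i+1}` has beyond
`D_i^q`. -/
theorem termE_tauS_add_one (f : Entire Fq σ) (i : σ → ℕ) :
    termE Fq ⟨tauS Fq f.1, tauS_mem_entire f⟩ (i + 1) = termE Fq f i ^ Fintype.card Fq := by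
  rw [termE, termE, smul_pow, ← Finset.prod_pow, evalAt_tauS, thetaPt_add_one, evalAt_tau, div_pow,
    ← Finset.prod_pow]
  congr 1
  · have hne : ∏ j, (thetaPt Fq i j ^ Fintype.card Fq - theta Fq) ≠ 0 := by
      refine Finset.prod_ne_zero_iff.2 fun j _ => ?_
      have := D_ne_zero Fq (i j + 1)
      rw [D_succ, pow_succ, pow_mul] at this
      exact left_ne_zero_of_mul this
    have hD : ∏ j, D Fq ((i + 1) j) = (∏ j, (thetaPt Fq i j ^ Fintype.card Fq - theta Fq)) *
        ∏ j, D Fq (i j) ^ Fintype.card Fq := by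
      rw [← Finset.prod_mul_distrib]
      refine Finset.prod_congr rfl fun j _ => ?_
      rw [Pi.add_apply, Pi.one_apply, D_succ, thetaPt, ← pow_mul, ← pow_succ]
    rw [hD, mul_div_mul_left _ _ hne]
  · refine Finset.prod_congr rfl fun j _ => ?_
    rw [← pow_mul, ← pow_succ]
    rfl

theorem termE_tauS_of_eq_zero (f : Entire Fq σ) {i : σ → ℕ} {j : σ} (h : i j = 0) :
    termE Fq ⟨tauS Fq f.1, tauS_mem_entire f⟩ i = 0 := by
  rw [termE, evalAt_tauS, Finset.prod_eq_zero (Finset.mem_univ j), zero_mul, zero_div, zero_smul]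
  rw [thetaPt, h, pow_zero, pow_one, sub_self]

omit [Fintype σ] in
theorem xSum_pow_card {ι : Type*} {g : ι → MvPowerSeries σ (CInf Fq)} (hg : XSummable g) :
    xSum (fun i => g i ^ Fintype.card Fq) = xSum g ^ Fintype.card Fq := by
  have h1 : ∀ h : MvPowerSeries σ (CInf Fq), h ^ Fintype.card Fq = h ^ Fintype.card Fq ^ 1 :=
    fun h => by rw [pow_one]
  ext m
  simp only [coeff_xSum, h1]
  by_cases hm : ∃ d : σ →₀ ℕ, m = Fintype.card Fq ^ 1 • d
  · obtain ⟨d, rfl⟩ := hm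
    simp only [coeff_smul_pow_card, coeff_xSum]
    exact ((powHom Fq 1).toAddMonoidHom.map_finsum (hg d)).symm
  · rw [not_imp_comm.1 (exists_eq_smul_of_coeff_pow_card_ne_zero Fq (xSum g)) hm]
    exact finsum_eq_zero_of_forall_eq_zero fun i =>
      not_imp_comm.1 (exists_eq_smul_of_coeff_pow_card_ne_zero Fq (g i)) hm

theorem mapE_tauS (f : Entire Fq σ) :
    mapE Fq ⟨tauS Fq f.1, tauS_mem_entire f⟩ = mapE Fq f ^ Fintype.card Fq := by
  change xSum (termE Fq _) = xSum (termE Fq f) ^ Fintype.card Fq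
  rw [← xSum_pow_card (xSummable_termE Fq f)]
  classical
  ext m
  rw [coeff_xSum, coeff_xSum]
  simp only [← termE_tauS_add_one]
  -- Indices outside the image of `i ↦ i + 1` have some `i_j = 0`, and their terms vanish.
  rw [← finsum_mem_range (f := fun i => MvPowerSeries.coeff m (termE Fq _ i))
    (add_left_injective (1 : σ → ℕ))]
  refine finsum_congr fun i => ?_
  by_cases hi : i ∈ Set.range fun k : σ → ℕ => k + 1
  · rw [finsum_eq_if, if_pos hi]
  · rw [finsum_eq_if, if_neg hi]
    obtain ⟨j, hj⟩ : ∃ j, i j = 0 := by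
      by_contra! h
      exact hi ⟨i - 1, funext fun j => Nat.sub_add_cancel (Nat.pos_of_ne_zero (h j))⟩
    rw [termE_tauS_of_eq_zero f hj, map_zero]

end FunctionalEquation

/-! ### Vanishing sums in the manner of Chevalley–Warning -/

section Vanishing
variable {Fq : Type*} [Field Fq] [Fintype Fq] {R : Type*} [CommRing R] (φ : Fq →+* R)

/-- The coefficients lie in `R`, not in `F_q`, so the vanishing over `F_q` is applied to each
monomial and carried over by `φ`. -/
theorem sum_eval_comp_eq_zero {σ : Type*} [Fintype σ] [DecidableEq σ] (f : MvPolynomial σ R)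
    (h : f.totalDegree < (Fintype.card Fq - 1) * Fintype.card σ) :
    ∑ c : σ → Fq, MvPolynomial.eval (fun i => φ (c i)) f = 0 := by
  simp only [MvPolynomial.eval_eq']
  rw [Finset.sum_comm]
  refine Finset.sum_eq_zero fun d hd => ?_
  have h0 := MvPolynomial.sum_eval_eq_zero (K := Fq) (MvPolynomial.monomial d 1)
    ((MvPolynomial.totalDegree_monomial_le _ _).trans_lt
      ((MvPolynomial.le_totalDegree hd).trans_lt h))
  have h1 := congrArg φ h0
  rw [map_sum, map_zero] at h1
  rw [← Finset.mul_sum]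
  refine mul_eq_zero_of_right _ ((Finset.sum_congr rfl fun c _ => ?_).trans h1)
  rw [MvPolynomial.eval_monomial, one_mul, Finsupp.prod_fintype _ _ (by simp), map_prod]
  simp only [map_pow]

open Polynomial in
theorem sum_prod_eval₂_eq_zero {ι : Type*} [Fintype ι] (x : ι → R) (d : ℕ)
    (h : Fintype.card ι < (Fintype.card Fq - 1) * d) :
    ∑ a : degreeLT Fq d, ∏ l, (X ^ d + a.1).eval₂ φ (x l) = 0 := by
  classical
  -- The coefficients of `a` become variables; each factor is then affine.
  let f : MvPolynomial (Fin d) R := ∏ l, (MvPolynomial.C (x l ^ d) +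
    ∑ i : Fin d, MvPolynomial.C (x l ^ (i : ℕ)) * MvPolynomial.X i)
  have hf : f.totalDegree ≤ Fintype.card ι := by
    refine (MvPolynomial.totalDegree_finsetProd _ _).trans ?_
    rw [← Finset.card_univ, Finset.card_eq_sum_ones]
    refine Finset.sum_le_sum fun l _ => (MvPolynomial.totalDegree_add _ _).trans (max_le ?_ ?_)
    · exact (MvPolynomial.totalDegree_C _).le.trans zero_le_one
    · refine MvPolynomial.totalDegree_finsetSum_le fun i _ => ?_
      refine (MvPolynomial.totalDegree_mul _ _).trans ?_
      rw [MvPolynomial.totalDegree_C, zero_add]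
      exact (MvPolynomial.totalDegree_monomial_le _ _).trans (by simp)
  rw [← sum_eval_comp_eq_zero φ f (hf.trans_lt (by rwa [Fintype.card_fin])),
    ← Equiv.sum_comp (degreeLTEquiv Fq d).symm.toEquiv]
  refine Finset.sum_congr rfl fun c _ => ?_
  simp only [f, map_prod, map_add, map_sum, map_mul, MvPolynomial.eval_C, MvPolynomial.eval_X]
  refine Finset.prod_congr rfl fun l _ => ?_
  change (X ^ d + ∑ i : Fin d, monomial i (c i)).eval₂ φ (x l) = _
  rw [eval₂_add, eval₂_X_pow, eval₂_finsetSum]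
  simp only [eval₂_monomial, mul_comm]

end Vanishing

/-! ### Decay of twisted power sums -/

section PowerSums
variable (Fq : Type*) [Field Fq] [Fintype Fq]

open Polynomial

/-- The twisted power sum `S_d(U; n) = ∑ χ_U(a) / a^n`, over the monic `a` of degree `d`. -/
def twistedSum (S : Finset ℕ+) (U : ℕ+ →₀ ℕ) (n d : ℕ) : MvPolynomial S (CInf Fq) :=
  ∑ a : degreeLT Fq d, ((embA Fq (X ^ d + a.1) ^ n)⁻¹ • chi Fq S U (X ^ d + a.1))

theorem embA_pow_card (a : Fq[X]) (t : ℕ) :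
    embA Fq a ^ Fintype.card Fq ^ t = a.eval₂ (embF Fq) (theta Fq ^ Fintype.card Fq ^ t) := by
  rw [← powHom_apply, embA, coe_eval₂RingHom, hom_eval₂, powHom_apply]
  congr 1
  exact RingHom.ext fun c => embF_pow_card Fq c t

theorem pow_card_pow_sub_one {M : Type*} [CommMonoid M] (x : M) (k : ℕ) :
    x ^ (Fintype.card Fq ^ k - 1) =
      ∏ t : Fin k, (x ^ Fintype.card Fq ^ (t : ℕ)) ^ (Fintype.card Fq - 1) := by
  rw [← Finset.prod_range fun t => (x ^ Fintype.card Fq ^ t) ^ (Fintype.card Fq - 1)]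
  induction k with
  | zero => simp
  | succ k ih =>
    rw [Finset.prod_range_succ, ← ih, ← pow_mul, ← pow_add]
    congr 1
    have h1 : 0 < Fintype.card Fq ^ k := pow_pos Fintype.card_pos k
    have h2 : Fintype.card Fq ^ k ≤ Fintype.card Fq ^ k * Fintype.card Fq :=
      Nat.le_mul_of_pos_right _ Fintype.card_pos
    rw [pow_succ, Nat.mul_sub, mul_one]
    omega

/-- The main term of `S_d(U; n)` modulo a high power of the maximal ideal vanishes. -/
theorem sum_pow_smul_chi_eq_zero (S : Finset ℕ+) (U : ℕ+ →₀ ℕ) {n k d : ℕ}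
    (h : n * k + ∑ j : S, U j < d) :
    ∑ a : degreeLT Fq d, (embA Fq (X ^ d + a.1) ^ (Fintype.card Fq ^ k - 1)) ^ n •
      chi Fq S U (X ^ d + a.1) = 0 := by
  -- The summand is a product of values of `a`: at each `θ^{q^t}`, `t < k`, repeated `n(q-1)` times,
  -- and at each `t_j`, repeated `U j` times.
  let x : (Fin n × Fin k × Fin (Fintype.card Fq - 1)) ⊕ (Σ j : S, Fin (U j)) →
      MvPolynomial S (CInf Fq) :=
    Sum.elim (fun l => MvPolynomial.C (theta Fq ^ Fintype.card Fq ^ (l.2.1 : ℕ)))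
      (fun l => MvPolynomial.X l.1)
  have hq : 1 < Fintype.card Fq := Fintype.one_lt_card
  rw [← sum_prod_eval₂_eq_zero (MvPolynomial.C.comp (embF Fq)) x d]
  · refine Finset.sum_congr rfl fun a _ => ?_
    rw [Fintype.prod_sum_type, Fintype.prod_sigma, Fintype.prod_prod_type]
    simp only [Fintype.prod_prod_type, x, Sum.elim_inl, Sum.elim_inr, Finset.prod_const,
      Finset.card_univ, Fintype.card_fin]
    rw [MvPolynomial.smul_eq_C_mul, pow_card_pow_sub_one]
    simp only [map_pow, map_prod]
    congr 1
    congr 1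
    refine Finset.prod_congr rfl fun t _ => ?_
    rw [← map_pow, embA_pow_card, hom_eval₂, map_pow]
  · simp only [Fintype.card_sum, Fintype.card_prod, Fintype.card_sigma, Fintype.card_fin]
    obtain ⟨e, he⟩ : ∃ e, Fintype.card Fq - 1 = e + 1 := ⟨Fintype.card Fq - 2, by omega⟩
    rw [he]
    have h1 : (e + 1) * (n * k + ∑ j : S, U j) < (e + 1) * d := by gcongr
    refine lt_of_le_of_lt ?_ h1
    calc n * (k * (e + 1)) + ∑ j : S, U j ≤ n * (k * (e + 1)) + (e + 1) * ∑ j : S, U j := by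
          gcongr
          exact Nat.le_mul_of_pos_left _ (Nat.succ_pos e)
      _ = _ := by ring

/-- The bound `q^{d-1}` is written multiplicatively to include `d = 0`. -/
theorem norm_embA_mul_le {d : ℕ} (r : degreeLT Fq d) :
    ‖embA Fq r.1‖ * Fintype.card Fq ≤ (Fintype.card Fq : ℝ) ^ d := by
  have hq : (1 : ℝ) < Fintype.card Fq := by exact_mod_cast Fintype.one_lt_card
  rcases eq_or_ne r.1 0 with h0 | h0
  · rw [h0, map_zero, norm_zero, zero_mul]
    positivity
  · have hd : r.1.natDegree < d := (natDegree_lt_iff_degree_lt h0).2 (mem_degreeLT.1 r.2)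
    rw [embA, coe_eval₂RingHom, eval₂_eq_sum_range' (embF Fq) hd, ← le_div_iff₀ (by positivity)]
    refine IsUltrametricDist.norm_sum_le_of_forall_le_of_nonneg (by positivity) fun i hi => ?_
    rw [norm_mul, norm_pow, norm_theta, le_div_iff₀ (by positivity), mul_assoc, ← pow_succ]
    calc _ ≤ 1 * (Fintype.card Fq : ℝ) ^ d := by
          gcongr
          · exact norm_embF_le Fq _
          · exact hq.le
          · exact Finset.mem_range.1 hi
      _ = _ := one_mul _

theorem norm_pow_sub_one_le {y : CInf Fq} (hy : ‖y‖ ≤ 1) (n : ℕ) : ‖y ^ n - 1‖ ≤ ‖y - 1‖ := by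
  rw [← geom_sum_mul, norm_mul]
  refine mul_le_of_le_one_left (norm_nonneg _) ?_
  refine IsUltrametricDist.norm_sum_le_of_forall_le_of_nonneg zero_le_one fun i _ => ?_
  rw [norm_pow]
  exact pow_le_one₀ (norm_nonneg _) hy

omit [Fintype Fq] in
theorem monic_X_pow_add_degreeLT {d : ℕ} (r : degreeLT Fq d) :
    (X ^ d + r.1).Monic ∧ (X ^ d + r.1).natDegree = d :=
  ((monicEquivDegreeLT d).symm r).2

theorem norm_inv_embA_pow_le_one {a : Fq[X]} (ha : a.Monic) (n : ℕ) :
    ‖(embA Fq a ^ n)⁻¹‖ ≤ 1 := by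
  have hq : (1 : ℝ) < Fintype.card Fq := by exact_mod_cast Fintype.one_lt_card
  rw [norm_inv, norm_pow, norm_embA Fq _ ha]
  exact inv_le_one_of_one_le₀ (one_le_pow₀ (one_le_pow₀ hq.le))

theorem theta_ne_zero : theta Fq ≠ 0 := by
  rw [← norm_ne_zero_iff, norm_theta]
  exact Nat.cast_ne_zero.2 Fintype.card_ne_zero

/-- `1/a^n` is approximated by a multiple of `a^{n(q^k-1)}`, uniformly in the monic `a` of
degree `d`. -/
theorem norm_inv_sub_le {d : ℕ} (r : degreeLT Fq d) (n k : ℕ) :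
    ‖(embA Fq (X ^ d + r.1) ^ n)⁻¹ - ((theta Fq ^ d) ^ (Fintype.card Fq ^ k * n))⁻¹ *
      (embA Fq (X ^ d + r.1) ^ (Fintype.card Fq ^ k - 1)) ^ n‖ ≤
        ((Fintype.card Fq : ℝ)⁻¹) ^ Fintype.card Fq ^ k := by
  obtain ⟨hm, hd⟩ := monic_X_pow_add_degreeLT Fq r
  have hθ : theta Fq ^ d ≠ 0 := pow_ne_zero _ (theta_ne_zero Fq)
  have hq0 : (Fintype.card Fq : ℝ) ≠ 0 := Nat.cast_ne_zero.2 Fintype.card_ne_zero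
  have hnθ : ‖theta Fq ^ d‖ = (Fintype.card Fq : ℝ) ^ d := by rw [norm_pow, norm_theta]
  have ha0 := embA_ne_zero Fq hm.ne_zero
  have hna := norm_embA Fq _ hm
  rw [hd] at hna
  have hr : embA Fq (X ^ d + r.1) / theta Fq ^ d - 1 = embA Fq r.1 / theta Fq ^ d := by
    rw [map_add, map_pow, show embA Fq X = theta Fq by simp [embA], add_div, div_self hθ]
    ring
  set a := embA Fq (X ^ d + r.1)
  set y := (a / theta Fq ^ d) ^ Fintype.card Fq ^ k with hy
  have hy1 : ‖y‖ ≤ 1 := by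
    rw [hy, norm_pow, norm_div, hna, hnθ, div_self (pow_ne_zero _ hq0), one_pow]
  have hy2 : ‖y - 1‖ ≤ ((Fintype.card Fq : ℝ)⁻¹) ^ Fintype.card Fq ^ k := by
    have h1 : y - 1 = (embA Fq r.1 / theta Fq ^ d) ^ Fintype.card Fq ^ k := by
      rw [← hr, ← powHom_apply, map_sub, map_one, powHom_apply]
    rw [h1, norm_pow, norm_div, hnθ]
    gcongr
    rw [div_le_iff₀ (by positivity), ← div_eq_inv_mul, le_div_iff₀ (by positivity)]
    exact norm_embA_mul_le Fq r
  -- The approximant equals `a^{-n} y^n`, and `y` is close to `1` because `y - 1` is the `q^k`-th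
  -- power of `r / θ^d`, of norm at most `1/q`.
  have key : (a ^ n)⁻¹ - ((theta Fq ^ d) ^ (Fintype.card Fq ^ k * n))⁻¹ *
      (a ^ (Fintype.card Fq ^ k - 1)) ^ n = (a ^ n)⁻¹ * -(y ^ n - 1) := by
    have hk : (a ^ Fintype.card Fq ^ k) = a ^ (Fintype.card Fq ^ k - 1) * a := by
      rw [← pow_succ, Nat.sub_add_cancel (pow_pos Fintype.card_pos k)]
    rw [hy, div_pow, hk, div_pow, mul_pow, pow_mul]
    field_simp
    ring
  rw [key, norm_mul, norm_neg]
  exact (mul_le_of_le_one_left (norm_nonneg _) (norm_inv_embA_pow_le_one Fq hm n)).trans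
    ((norm_pow_sub_one_le Fq hy1 n).trans hy2)

theorem coeffLE_twistedSum (S : Finset ℕ+) (U : ℕ+ →₀ ℕ) {n k d : ℕ}
    (h : n * k + ∑ j : S, U j < d) :
    CoeffLE Fq (((Fintype.card Fq : ℝ)⁻¹) ^ Fintype.card Fq ^ k) (twistedSum Fq S U n d) := by
  intro m
  -- Subtracting this vanishing sum replaces each `1/a^n` by its approximation error.
  have h0 := congrArg (((theta Fq ^ d) ^ (Fintype.card Fq ^ k * n))⁻¹ • ·)
    (sum_pow_smul_chi_eq_zero Fq S U h)
  simp only [smul_zero, Finset.smul_sum, smul_smul] at h0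
  rw [← sub_zero (twistedSum Fq S U n d), ← h0, twistedSum, ← Finset.sum_sub_distrib,
    MvPolynomial.coeff_sum]
  refine IsUltrametricDist.norm_sum_le_of_forall_le_of_nonneg (by positivity) fun r _ => ?_
  rw [← sub_smul, MvPolynomial.coeff_smul, smul_eq_mul, norm_mul]
  exact (mul_le_of_le_one_right (norm_nonneg _) (coeffLE_chi Fq S U _ m)).trans
    (norm_inv_sub_le Fq r n k)

end PowerSums

/-! ### Coefficients of multiple zeta values -/

section ZetaEntire
variable {Fq : Type*} [Field Fq] [Fintype Fq]

open Filter Topology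

theorem norm_tsum_le_of_forall_norm_le {ι : Type*} {F : ι → CInf Fq} {r : ℝ} (hr : 0 ≤ r)
    (h : ∀ i, ‖F i‖ ≤ r) : ‖∑' i, F i‖ ≤ r := by
  by_cases hF : Summable F
  · exact le_of_tendsto hF.hasSum.norm (Eventually.of_forall fun s =>
      IsUltrametricDist.norm_sum_le_of_forall_le_of_nonneg hr fun i _ => h i)
  · rwa [tsum_eq_zero_of_not_summable hF, norm_zero]

theorem totalDegree_substVar_le {σ : Type*} (j : σ) (a : Polynomial Fq) :
    (substVar Fq j a).totalDegree ≤ a.natDegree := by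
  rw [substVar, Polynomial.coe_eval₂RingHom, Polynomial.eval₂_eq_sum_range]
  refine MvPolynomial.totalDegree_finsetSum_le fun i hi => ?_
  refine (MvPolynomial.totalDegree_mul _ _).trans ?_
  rw [RingHom.comp_apply, MvPolynomial.totalDegree_C, zero_add]
  refine (MvPolynomial.totalDegree_pow _ _).trans ?_
  rw [MvPolynomial.totalDegree_X, mul_one]
  exact Nat.lt_succ_iff.1 (Finset.mem_range.1 hi)

theorem totalDegree_chi_le (S : Finset ℕ+) (U : ℕ+ →₀ ℕ) (a : Polynomial Fq) :
    (chi Fq S U a).totalDegree ≤ (∑ j : S, U j) * a.natDegree := by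
  refine (MvPolynomial.totalDegree_finsetProd _ _).trans ?_
  rw [Finset.sum_mul]
  refine Finset.sum_le_sum fun j _ => (MvPolynomial.totalDegree_pow _ _).trans ?_
  exact Nat.mul_le_mul_left _ (totalDegree_substVar_le _ _)

theorem coeff_eq_zero_of_totalDegree_lt {σ : Type*} {P : MvPolynomial σ (CInf Fq)} {m : σ →₀ ℕ}
    (h : P.totalDegree < m.degree) : MvPolynomial.coeff m P = 0 :=
  MvPolynomial.coeff_eq_zero_of_totalDegree_lt h

variable (S : Finset ℕ+) (C : CompArray)

theorem totalDegree_zetaTerm_le (i₀ : Fin C.length) (hi₀ : ∀ i, i₀ ≤ i)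
    (a : DecTuple Fq C.length) : (zetaTerm Fq S C a).totalDegree ≤
      (∑ i : Fin C.length, ∑ j : S, C[i].1 j) * (a.1 i₀).natDegree := by
  refine (MvPolynomial.totalDegree_finsetProd _ _).trans ?_
  rw [Finset.sum_mul]
  refine Finset.sum_le_sum fun i _ => (MvPolynomial.totalDegree_smul_le _ _).trans ?_
  exact (totalDegree_chi_le _ _ _).trans (Nat.mul_le_mul_left _ (a.2.2.antitone (hi₀ i)))

/-- The tuple obtained from `b` by replacing its leading entry by another monic polynomial of the
same degree. -/
def replaceLead {r : ℕ} (i₀ : Fin r) (b : DecTuple Fq r)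
    (p : Polynomial.degreeLT Fq (b.1 i₀).natDegree) : DecTuple Fq r :=
  ⟨Function.update b.1 i₀ (Polynomial.X ^ (b.1 i₀).natDegree + p.1), by
    obtain ⟨h1, h2⟩ := monic_X_pow_add_degreeLT Fq p
    refine ⟨fun i => ?_, ?_⟩
    · rcases eq_or_ne i i₀ with rfl | hi
      · rwa [Function.update_self]
      · rw [Function.update_of_ne hi]
        exact b.2.1 i
    · convert b.2.2 using 2 with i
      rcases eq_or_ne i i₀ with rfl | hi
      · rw [Function.update_self, h2]
      · rw [Function.update_of_ne hi]⟩

omit [Fintype Fq] in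
theorem replaceLead_injective {r : ℕ} (i₀ : Fin r) (b : DecTuple Fq r) :
    Function.Injective (replaceLead i₀ b) := fun p p' h => by
  have h1 := congrFun (congrArg Subtype.val h) i₀
  simp only [replaceLead, Function.update_self] at h1
  exact Subtype.ext (add_left_cancel h1)

/-- The degree of the leading entry of a tuple, and the other entries. -/
def leadDegree {r : ℕ} (i₀ : Fin r) (a : DecTuple Fq r) : ℕ × (Fin r → Polynomial Fq) :=
  ((a.1 i₀).natDegree, Function.update a.1 i₀ 0)

omit [Fintype Fq] in
-- Only the degree of the leading entry is constrained by the others, so it runs through all monic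
-- polynomials of that degree and a fibre sums to a full twisted power sum.
theorem fiber_leadDegree {r : ℕ} (i₀ : Fin r) (b : DecTuple Fq r) :
    leadDegree i₀ ⁻¹' {leadDegree i₀ b} = Set.range (replaceLead i₀ b) := by
  ext a
  constructor
  · intro h
    obtain ⟨h1, h2⟩ := Prod.ext_iff.1 (Set.mem_singleton_iff.1 h)
    change (a.1 i₀).natDegree = (b.1 i₀).natDegree at h1
    change Function.update a.1 i₀ 0 = Function.update b.1 i₀ 0 at h2
    let p := Polynomial.monicEquivDegreeLT _ ⟨a.1 i₀, a.2.1 i₀, h1⟩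
    refine ⟨p, Subtype.ext ?_⟩
    have hp : Polynomial.X ^ (b.1 i₀).natDegree + p.1 = a.1 i₀ :=
      congrArg Subtype.val ((Polynomial.monicEquivDegreeLT _).symm_apply_apply
        ⟨a.1 i₀, a.2.1 i₀, h1⟩)
    simp only [replaceLead]
    rw [hp]
    funext i
    rcases eq_or_ne i i₀ with rfl | hi
    · rw [Function.update_self]
    · rw [Function.update_of_ne hi]
      simpa [Function.update_of_ne hi] using (congrFun h2 i).symm
  · rintro ⟨p, rfl⟩
    refine Prod.ext ?_ ?_
    · simp [leadDegree, replaceLead, (monic_X_pow_add_degreeLT Fq p).2]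
    · simp [leadDegree, replaceLead]

theorem sum_zetaTerm_replaceLead (i₀ : Fin C.length) (b : DecTuple Fq C.length) :
    ∑ p, zetaTerm Fq S C (replaceLead i₀ b p) =
      twistedSum Fq S C[i₀].1 C[i₀].2 (b.1 i₀).natDegree *
        ∏ i ∈ Finset.univ.erase i₀,
          ((embA Fq (b.1 i) ^ (C[i].2 : ℕ))⁻¹ • chi Fq S C[i].1 (b.1 i)) := by
  rw [twistedSum, Finset.sum_mul]
  refine Finset.sum_congr rfl fun p _ => ?_
  rw [zetaTerm, ← Finset.mul_prod_erase _ _ (Finset.mem_univ i₀)]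
  congr 1
  · simp [replaceLead]
  · refine Finset.prod_congr rfl fun i hi => ?_
    simp only [replaceLead, Function.update_of_ne (Finset.ne_of_mem_erase hi)]

theorem coeffLE_prod_erase (i₀ : Fin C.length) (b : DecTuple Fq C.length) :
    CoeffLE Fq 1 (∏ i ∈ Finset.univ.erase i₀,
      ((embA Fq (b.1 i) ^ (C[i].2 : ℕ))⁻¹ • chi Fq S C[i].1 (b.1 i))) := by
  have := coeffLE_prod Fq (Finset.univ.erase i₀)
    (fun i : Fin C.length => (embA Fq (b.1 i) ^ (C[i].2 : ℕ))⁻¹ • chi Fq S C[i].1 (b.1 i))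
    (fun _ => 1) (fun _ => zero_le_one) (fun i m => by
      rw [MvPolynomial.coeff_smul, smul_eq_mul, norm_mul]
      exact mul_le_one₀ (norm_inv_embA_pow_le_one Fq (b.2.1 i) _) (norm_nonneg _)
        (coeffLE_chi Fq S _ _ m))
  rwa [Finset.prod_const_one] at this

/-- The coefficients of a multiple zeta value decrease doubly exponentially. -/
theorem norm_coeff_zeta_le (i₀ : Fin C.length) (hi₀ : ∀ i, i₀ ≤ i) {m : S →₀ ℕ} {k : ℕ}
    (h : (∑ i : Fin C.length, ∑ j : S, C[i].1 j) * (C[i₀].2 * k + ∑ j : S, C[i₀].1 j) <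
      m.degree) :
    ‖MvPowerSeries.coeff m (zeta Fq S C)‖ ≤
      ((Fintype.card Fq : ℝ)⁻¹) ^ Fintype.card Fq ^ k := by
  set W := ∑ i : Fin C.length, ∑ j : S, C[i].1 j
  have hr : (0 : ℝ) ≤ ((Fintype.card Fq : ℝ)⁻¹) ^ Fintype.card Fq ^ k := by positivity
  have hs := (summable_zetaTerm Fq S C m).hasSum.tsum_fiberwise (leadDegree i₀)
  change ‖∑' a, MvPolynomial.coeff m (zetaTerm Fq S C a)‖ ≤ _
  rw [← hs.tsum_eq]
  refine norm_tsum_le_of_forall_norm_le hr fun c => ?_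
  by_cases hc : ∃ b, leadDegree i₀ b = c
  · obtain ⟨b, rfl⟩ := hc
    rw [fiber_leadDegree, tsum_range (fun a => MvPolynomial.coeff m (zetaTerm Fq S C a))
      (replaceLead_injective i₀ b), tsum_fintype, ← MvPolynomial.coeff_sum,
      sum_zetaTerm_replaceLead]
    -- If the leading degree `d` satisfies `W d < |m|`, every term has total degree below `|m|`.
    -- Otherwise cancelling `W` in `h` makes `d` large enough for `coeffLE_twistedSum`.
    by_cases hd : W * (b.1 i₀).natDegree < m.degree
    · rw [← sum_zetaTerm_replaceLead, MvPolynomial.coeff_sum, Finset.sum_eq_zero, norm_zero]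
      · exact hr
      · intro p _
        refine coeff_eq_zero_of_totalDegree_lt
          ((totalDegree_zetaTerm_le S C i₀ hi₀ _).trans_lt ?_)
        simp only [replaceLead, Function.update_self]
        rwa [(monic_X_pow_add_degreeLT Fq p).2]
    · have hlt := lt_of_mul_lt_mul_left (h.trans_le (not_lt.1 hd)) (Nat.zero_le _)
      have := (coeffLE_twistedSum Fq S C[i₀].1 hlt).mul hr zero_le_one
        (coeffLE_prod_erase S C i₀ b) m
      rwa [mul_one] at this
  · have : IsEmpty (leadDegree i₀ ⁻¹' {c}) := ⟨fun b => hc ⟨b.1, b.2⟩⟩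
    rw [tsum_empty, norm_zero]
    exact hr

end ZetaEntire

/-! ### From doubly exponential decay to entire functions -/

section Growth
open Filter Topology

/-- With `T < q^c`, `T^k` is at most `(q^k)^c`, a fixed power of `q^k`, against the exponential
`q^{q^k}`. -/
theorem tendsto_pow_mul_inv_pow_pow {q : ℕ} (hq : 1 < q) (T : ℝ) (hT : 1 ≤ T) :
    Tendsto (fun k : ℕ => T ^ k * ((q : ℝ)⁻¹) ^ q ^ k) atTop (𝓝 0) := by
  have hq' : (1 : ℝ) < q := by exact_mod_cast hq
  obtain ⟨c, hc⟩ := pow_unbounded_of_one_lt T hq'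
  have h := (tendsto_pow_const_div_const_pow_of_one_lt c hq').comp
    (tendsto_pow_atTop_atTop_of_one_lt hq)
  refine squeeze_zero (fun k => by positivity) (fun k => ?_) h
  rw [Function.comp_apply, inv_pow, ← div_eq_mul_inv]
  gcongr
  calc T ^ k ≤ ((q : ℝ) ^ c) ^ k := by gcongr
    _ = _ := by push_cast; ring

theorem tendsto_degree_cofinite (σ : Type*) [Finite σ] :
    Tendsto (fun k : σ →₀ ℕ => k.degree) cofinite atTop := by
  classical
  have := Fintype.ofFinite σ
  refine tendsto_atTop.2 fun N => mem_cofinite.2 ?_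
  refine (Set.finite_Iic (Finsupp.equivFunOnFinite.symm fun _ : σ => N)).subset fun k hk j => ?_
  have hk' : k.degree < N := not_le.1 hk
  exact (Finsupp.le_degree j k).trans hk'.le

theorem mem_entire_of_norm_coeff_le {Fq : Type*} [Field Fq] [Fintype Fq] {σ : Type*} [Fintype σ]
    {f : MvPowerSeries σ (CInf Fq)} (α β : ℕ)
    (h : ∀ m k, α * k + β < m.degree →
      ‖MvPowerSeries.coeff m f‖ ≤ ((Fintype.card Fq : ℝ)⁻¹) ^ Fintype.card Fq ^ k) :
    f ∈ Entire Fq σ := by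
  intro R hR
  set T := max R 1
  have hT : 1 ≤ T := le_max_right _ _
  -- This `k` satisfies `αk + β < |m| ≤ (α+1)k + α + β + 2` for large `|m|`; dividing by `α + 1`
  -- avoids division by zero.
  have hk : Tendsto (fun m : σ →₀ ℕ => (m.degree - (β + 1)) / (α + 1)) cofinite atTop :=
    (Nat.tendsto_div_const_atTop (Nat.succ_ne_zero α)).comp
      ((tendsto_sub_atTop_nat (β + 1)).comp (tendsto_degree_cofinite σ))
  have hlim := ((tendsto_pow_mul_inv_pow_pow (Fintype.one_lt_card (α := Fq)) (T ^ (α + 1))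
    (one_le_pow₀ hT)).comp hk).const_mul (T ^ (α + β + 2))
  rw [mul_zero] at hlim
  refine squeeze_zero' (Eventually.of_forall fun m => by positivity) ?_ hlim
  filter_upwards [(tendsto_degree_cofinite σ).eventually_ge_atTop (β + 1)] with m hm
  rw [Function.comp_apply]
  set k := (m.degree - (β + 1)) / (α + 1) with hkdef
  have h1 : (α + 1) * k ≤ m.degree - (β + 1) := Nat.mul_div_le _ _
  have h2 : m.degree - (β + 1) < (α + 1) * k + (α + 1) := by
    have := Nat.lt_mul_div_succ (m.degree - (β + 1)) (Nat.succ_pos α)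
    rwa [Nat.succ_eq_add_one, mul_add, mul_one] at this
  have h3 : α * k ≤ (α + 1) * k := Nat.mul_le_mul_right _ (Nat.le_succ α)
  calc ‖MvPowerSeries.coeff m f‖ * R ^ m.degree
      ≤ ((Fintype.card Fq : ℝ)⁻¹) ^ Fintype.card Fq ^ k * T ^ ((α + 1) * k + (α + β + 2)) := by
        refine mul_le_mul (h m k (by omega)) ?_ (by positivity) (by positivity)
        calc R ^ m.degree ≤ T ^ m.degree := by gcongr; exact le_max_left _ _
          _ ≤ _ := pow_le_pow_right₀ hT (by omega)
    _ = _ := by rw [pow_add, pow_mul]; ring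

end Growth

/-! ### Zeta values are entire -/

section Main
variable (Fq : Type*) [Field Fq] [Fintype Fq]

open Filter

theorem zeta_mem_entire (S : Finset ℕ+) {C : CompArray} (hC : C ≠ [] ∨ S = ∅) :
    zeta Fq S C ∈ Entire Fq S := by
  by_cases h0 : C = []
  · obtain rfl : S = ∅ := hC.resolve_left (not_not_intro h0)
    intro R hR
    -- Without variables there is only one exponent, so the condition is vacuous.
    rw [cofinite_eq_bot]
    exact tendsto_bot
  · have hpos : 0 < C.length := List.length_pos_of_ne_nil h0
    refine mem_entire_of_norm_coeff_le
      ((∑ i : Fin C.length, ∑ j : S, C[i].1 j) * C[(⟨0, hpos⟩ : Fin C.length)].2)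
      ((∑ i : Fin C.length, ∑ j : S, C[i].1 j) * ∑ j : S, C[(⟨0, hpos⟩ : Fin C.length)].1 j)
      fun m k h => norm_coeff_zeta_le S C ⟨0, hpos⟩ (fun i => Nat.zero_le _) ?_
    rwa [mul_add, ← mul_assoc]

theorem zetaSpace_le_entire (S : Finset ℕ+) :
    zetaSpace Fq S ≤ (Entire Fq S).toAddSubgroup := by
  refine iSup_le fun n => (AddSubgroup.closure_le _).2 ?_
  rintro _ ⟨C, hC, -, rfl⟩
  refine zeta_mem_entire Fq S ?_
  -- The empty array has type `0`, which is not the indicator of a nonempty `S`.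
  by_contra! h
  obtain ⟨rfl, j, hj⟩ := h
  have h1 := DFunLike.congr_fun hC j
  rw [CompArray.type, List.map_nil, List.sum_nil, Finsupp.finsetSum_apply] at h1
  simp [Finsupp.single_apply, hj] at h1

end Main

end TateMZV

end

theorem corollary6p7 (Fq : Type*) [Field Fq] [Fintype Fq] (S : Finset ℕ+) :
    -- the two maps agree on the whole space of entire functions, with values in the linear series
    ((TateMZV.mapE Fq : TateMZV.Entire Fq S →ₗ[TateMZV.CInf Fq] MvPowerSeries S (TateMZV.CInf Fq)) =
        TateMZV.mapF Fq ∧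
      ∀ f : TateMZV.Entire Fq S, TateMZV.mapE Fq f ∈ TateMZV.linSeries Fq S) ∧
    -- they agree on the space of multiple zeta values of type `S`, which consists of entire functions
    (S.card < Fintype.card Fq → ∀ f ∈ TateMZV.zetaSpace Fq S,
      ∃ hf : f ∈ TateMZV.Entire Fq S, TateMZV.mapE Fq ⟨f, hf⟩ = TateMZV.mapF Fq ⟨f, hf⟩) ∧
    -- the polylogarithm is the Carlitz logarithm
    (∀ j : S, TateMZV.lam Fq j = TateMZV.carlitzLog Fq j) ∧
    -- the functional equation
    (∀ f : TateMZV.Entire Fq S, ∃ hf : TateMZV.tauS Fq f.1 ∈ TateMZV.Entire Fq S,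
      TateMZV.mapE Fq ⟨TateMZV.tauS Fq f.1, hf⟩ = TateMZV.mapE Fq f ^ Fintype.card Fq) :=
  ⟨⟨TateMZV.mapE_eq_mapF, fun f => by
      rw [TateMZV.mapE_eq_mapF]
      exact TateMZV.mapF_mem_linSeries f⟩,
    fun _ f hf => ⟨TateMZV.zetaSpace_le_entire Fq S hf, by rw [TateMZV.mapE_eq_mapF]⟩,
    fun j => TateMZV.lam_eq_carlitzLog Fq j,
    fun f => ⟨TateMZV.tauS_mem_entire f, TateMZV.mapE_tauS f⟩⟩
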